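/- Let $N\in\mathbb N$, $N\ge 5$, $\alpha>0$, $\beta>(\alpha-2)^+=\max\{\alpha-2,0\}$, $a(x)=1+|x|^\alpha$ and $V(x)=|x|^\beta$ for $x\in\mathbb R^N$, and for $\lambda\in\mathbb R$ consider on the complex-valued functions $u,v\in C_c^\infty(\mathbb R^N\setminus\{0\})$ the sesquilinear form $$\mathfrak a_\lambda(u,v)=\int_{\mathbb R^N}\Big[a^2\,\Delta u\,\Delta\overline v+2\,(\nabla a^2\cdot\nabla\overline v)\,\Delta u+(\Delta a^2)\,\Delta u\,\overline v+(V^2+\lambda)\,u\,\overline v\Big]\,dx ,\qquad \|u\|_{\mathfrak a_\lambda}^2=\operatorname{Re}\mathfrak a_\lambda(u,u)+\|u\|_{2}^2 .$$ There are $\lambda_0>0$ (depending only on $N,\alpha,\beta$), a linear operator $(A,D(A))$ on the complex Hilbert space $L^2(\mathbb R^N)$ that extends $u\mapsto a^2\Delta^2u+V^2u$ on $C_c^\infty(\mathbb R^N\setminus\{0\})$, and an analytic $C_0$-semigroup $(e^{-tA})_{t\ge0}$ on $L^2(\mathbb R^N)$ with generator $-A$, such that the following holds for every $\lambda\ge\lambda_0$.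 (i) The form $\mathfrak a_\lambda$ is densely defined in $L^2(\mathbb R^N)$, accretive ($\operatorname{Re}\mathfrak a_\lambda(u,u)\ge0$), continuous ($|\mathfrak a_\lambda(u,v)|\le M\|u\|_{\mathfrak a_\lambda}\|v\|_{\mathfrak a_\lambda}$ for some $M$) and closable (if $u_n\to0$ in $L^2(\mathbb R^N)$ and $(u_n)$ is Cauchy for $\|\cdot\|_{\mathfrak a_\lambda}$, then $\mathfrak a_\lambda(u_n,u_n)\to0$). Hence its closure $\overline{\mathfrak a}_\lambda$ is well defined: $D(\overline{\mathfrak a}_\lambda)$ is the set of $L^2$-limits of sequences in $C_c^\infty(\mathbb R^N\setminus\{0\})$ that converge in $L^2(\mathbb R^N)$ and are Cauchy for $\|\cdot\|_{\mathfrak a_\lambda}$, and $\overline{\mathfrak a}_\lambda(u,v)=\lim_n\mathfrak a_\lambda(u_n,v_n)$ along any such sequences $u_n\to u$, $v_n\to v$. (ii) Let $A_\lambda$ be the operator associated with $\overline{\mathfrak a}_\lambda$: $u\in D(A_\lambda)$ and $A_\lambda u=f$ if and only if $u\in D(\overline{\mathfrak a}_\lambda)$, $f\in L^2(\mathbb R^N)$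 and $\overline{\mathfrak a}_\lambda(u,h)=\int_{\mathbb R^N}f\,\overline h\,dx$ for all $h\in D(\overline{\mathfrak a}_\lambda)$. Then $A_\lambda$ is a (single-valued) linear operator, and $-A_\lambda$ generates a strongly continuous analytic contraction semigroup $(e^{-tA_\lambda})_{t\ge0}$ on $L^2(\mathbb R^N)$, that is, a $C_0$-semigroup of contractions which extends, for some $\theta\in(0,\pi/2]$, to an analytic semigroup on the sector $\{z\ne0:|\arg z|<\theta\}$, contractive there and strongly continuous at $0$ on every smaller sector. (iii) $D(A)=D(A_\lambda)$, $A_\lambda=A+\lambda$, and $e^{-tA}=e^{\lambda t}e^{-tA_\lambda}$ for all $t\ge0$. -/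

import Mathlib

open MeasureTheory Filter Topology
open scoped Distributions

noncomputable section

namespace BiLaplace

/-! ### Sesquilinear forms on a dense space of test elements, their closure, the associated operator

`𝒟` is the form domain, `j : 𝒟 → H` its embedding into the Hilbert space `H`, and
`q u v` is the form (linear in `u`, conjugate-linear in `v`). -/

section Forms

/-- The form norm `‖u‖_q = (Re q(u,u) + ‖u‖²)^(1/2)` of an accretive form. -/
def formNorm {𝒟 H : Type*} [NormedAddCommGroup H] (j : 𝒟 → H) (q : 𝒟 → 𝒟 → ℂ) (u : 𝒟) : ℝ :=
  Real.sqrt ((q u u).re + ‖j u‖ ^ 2)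

/-- Accretivity: `Re q(u,u) ≥ 0`. -/
def Accretive {𝒟 : Type*} (q : 𝒟 → 𝒟 → ℂ) : Prop :=
  ∀ u, 0 ≤ (q u u).re

/-- Continuity of the form with respect to its form norm. -/
def ContinuousForm {𝒟 H : Type*} [NormedAddCommGroup H] (j : 𝒟 → H) (q : 𝒟 → 𝒟 → ℂ) : Prop :=
  ∃ M : ℝ, ∀ u v, ‖q u v‖ ≤ M * formNorm j q u * formNorm j q v

/-- `φ` is a Cauchy sequence for the form norm. -/
def FormCauchy {𝒟 H : Type*} [AddCommGroup 𝒟] [NormedAddCommGroup H]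
    (j : 𝒟 → H) (q : 𝒟 → 𝒟 → ℂ) (φ : ℕ → 𝒟) : Prop :=
  ∀ ε : ℝ, 0 < ε → ∃ K : ℕ, ∀ m ≥ K, ∀ n ≥ K, formNorm j q (φ m - φ n) < ε

/-- `φ` is form-Cauchy and converges to `u` in `H`. -/
def Approximates {𝒟 H : Type*} [AddCommGroup 𝒟] [NormedAddCommGroup H]
    (j : 𝒟 → H) (q : 𝒟 → 𝒟 → ℂ) (φ : ℕ → 𝒟) (u : H) : Prop :=
  FormCauchy j q φ ∧ Tendsto (fun n => j (φ n)) atTop (𝓝 u)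

/-- Closability: a form-Cauchy sequence that tends to `0` in `H` satisfies `q(φₙ,φₙ) → 0`. -/
def Closable {𝒟 H : Type*} [AddCommGroup 𝒟] [NormedAddCommGroup H]
    (j : 𝒟 → H) (q : 𝒟 → 𝒟 → ℂ) : Prop :=
  ∀ φ : ℕ → 𝒟, Approximates j q φ 0 → Tendsto (fun n => q (φ n) (φ n)) atTop (𝓝 0)

/-- The domain of the closure of the form. -/
def closureDomain {𝒟 H : Type*} [AddCommGroup 𝒟] [NormedAddCommGroup H]
    (j : 𝒟 → H) (q : 𝒟 → 𝒟 → ℂ) : Set H :=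
  {u | ∃ φ : ℕ → 𝒟, Approximates j q φ u}

/-- `q̄(u,v) = c` for the closure `q̄` of the form (`u`, `v` in `closureDomain j q`):
`q(φₙ,ψₙ) → c` along the sequences that approximate `u` and `v`. -/
def ClosureValue {𝒟 H : Type*} [AddCommGroup 𝒟] [NormedAddCommGroup H]
    (j : 𝒟 → H) (q : 𝒟 → 𝒟 → ℂ) (u v : H) (c : ℂ) : Prop :=
  ∀ φ ψ : ℕ → 𝒟, Approximates j q φ u → Approximates j q ψ v →
    Tendsto (fun n => q (φ n) (ψ n)) atTop (𝓝 c)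

/-- The graph of the operator associated with the closure of the form: `u` lies in the domain and
is mapped to `f` when `q̄(u,h) = ⟨f,h⟩` for all `h` in the domain of the closure
(`inner ℂ h f` is linear in `f`). -/
def AssociatedGraph {𝒟 H : Type*} [AddCommGroup 𝒟] [NormedAddCommGroup H] [InnerProductSpace ℂ H]
    (j : 𝒟 → H) (q : 𝒟 → 𝒟 → ℂ) (u f : H) : Prop :=
  u ∈ closureDomain j q ∧ ∀ h ∈ closureDomain j q, ClosureValue j q u h (inner ℂ h f)

end Forms

/-! ### Semigroups -/

section Semigroups

/-- `(T t)_{t ≥ 0}` is a strongly continuous semigroup (values at negative times are irrelevant). -/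
structure IsC0Semigroup {H : Type*} [NormedAddCommGroup H] [NormedSpace ℂ H]
    (T : ℝ → H →L[ℂ] H) : Prop where
  map_zero : T 0 = 1
  map_add : ∀ s t : ℝ, 0 ≤ s → 0 ≤ t → T (s + t) = T s * T t
  continuousOn : ∀ x : H, ContinuousOn (fun t => T t x) (Set.Ici 0)

/-- `B` is the (infinitesimal) generator of the semigroup `T`. -/
def IsGenerator {H : Type*} [NormedAddCommGroup H] [NormedSpace ℂ H]
    (T : ℝ → H →L[ℂ] H) (B : H →ₗ.[ℂ] H) : Prop :=
  ∀ u w : H, (u, w) ∈ B.graph ↔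
    Tendsto (fun t : ℝ => ((t⁻¹ : ℝ) : ℂ) • (T t u - u)) (𝓝[>] 0) (𝓝 w)

/-- The open sector of half-angle `θ` around the positive real axis. -/
def sector (θ : ℝ) : Set ℂ := {z | z ≠ 0 ∧ |z.arg| < θ}

/-- `S` extends the semigroup `T` to the sector of half-angle `θ` as an analytic semigroup. -/
structure IsAnalyticExtension {H : Type*} [NormedAddCommGroup H] [NormedSpace ℂ H]
    (T : ℝ → H →L[ℂ] H) (θ : ℝ) (S : ℂ → H →L[ℂ] H) : Prop where
  angle_pos : 0 < θ
  angle_le : θ ≤ Real.pi / 2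
  extends_real : ∀ t : ℝ, 0 ≤ t → S t = T t
  map_add : ∀ z ∈ sector θ, ∀ w ∈ sector θ, S (z + w) = S z * S w
  differentiableOn : DifferentiableOn ℂ S (sector θ)
  tendsto_zero : ∀ θ' : ℝ, 0 < θ' → θ' < θ → ∀ x : H,
    Tendsto (fun z => S z x) (𝓝[sector θ'] 0) (𝓝 x)

/-- An analytic `C₀`-semigroup. -/
def IsAnalyticSemigroup {H : Type*} [NormedAddCommGroup H] [NormedSpace ℂ H]
    (T : ℝ → H →L[ℂ] H) : Prop :=
  IsC0Semigroup T ∧ ∃ (θ : ℝ) (S : ℂ → H →L[ℂ] H), IsAnalyticExtension T θ S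

/-- A strongly continuous analytic contraction semigroup: an analytic `C₀`-semigroup of
contractions, also on a sector. -/
def IsAnalyticContractionSemigroup {H : Type*} [NormedAddCommGroup H] [NormedSpace ℂ H]
    (T : ℝ → H →L[ℂ] H) : Prop :=
  IsC0Semigroup T ∧ (∀ t : ℝ, 0 ≤ t → ‖T t‖ ≤ 1) ∧
    ∃ (θ : ℝ) (S : ℂ → H →L[ℂ] H), IsAnalyticExtension T θ S ∧ ∀ z ∈ sector θ, ‖S z‖ ≤ 1

end Semigroups

/-! ### The operator `a² Δ² + V²` and its form -/

section Operator

/-- `ℝ^N` with the Euclidean norm. -/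
abbrev Space (N : ℕ) : Type := EuclideanSpace ℝ (Fin N)

/-- The complex Hilbert space `L²(ℝ^N)`. -/
abbrev L2 (N : ℕ) : Type := Lp ℂ 2 (volume : Measure (Space N))

/-- The open set `ℝ^N \ {0}`. -/
def punctured (N : ℕ) : TopologicalSpace.Opens (Space N) := ⟨{0}ᶜ, isOpen_compl_singleton⟩

/-- `C_c^∞(ℝ^N \ {0})`, complex-valued. -/
abbrev Test (N : ℕ) : Type := 𝓓(punctured N, ℂ)

/-- The class in `L²` of a test function. -/
def toL2 {N : ℕ} (u : Test N) : L2 N :=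
  MemLp.toLp (⇑u) (u.continuous.memLp_of_hasCompactSupport u.hasCompactSupport)

/-- The square `a²` of the diffusion coefficient `a(x) = 1 + |x|^α`. -/
def aSq {N : ℕ} (α : ℝ) (x : Space N) : ℝ := (1 + ‖x‖ ^ α) ^ 2

/-- The potential `V(x) = |x|^β`. -/
def V {N : ℕ} (β : ℝ) (x : Space N) : ℝ := ‖x‖ ^ β

/-- The differential expression `a² Δ² u + V² u`. -/
def diffExpr {N : ℕ} (α β : ℝ) (u : Space N → ℂ) (x : Space N) : ℂ :=
  (aSq α x : ℂ) * Laplacian.laplacian (Laplacian.laplacian u) x + ((V β x) ^ 2 : ℝ) * u x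

/-- The form
`𝔞_λ(u,v) = ∫ a² Δu Δv̄ + 2 (∇a² · ∇v̄) Δu + (Δa²) Δu v̄ + (V² + λ) u v̄`
on `C_c^∞(ℝ^N \ {0})`. -/
def form {N : ℕ} (α β lam : ℝ) (u v : Test N) : ℂ :=
  ∫ x : Space N,
    ((aSq α x : ℂ) * starRingEnd ℂ (Laplacian.laplacian (⇑v) x) * Laplacian.laplacian (⇑u) x
      + 2 * starRingEnd ℂ (fderiv ℝ (⇑v) x (gradient (aSq α) x)) * Laplacian.laplacian (⇑u) x
      + (Laplacian.laplacian (aSq (N := N) α) x : ℂ) * Laplacian.laplacian (⇑u) x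
          * starRingEnd ℂ (v x)
      + ((V β x ^ 2 + lam : ℝ) : ℂ) * u x * starRingEnd ℂ (v x))

end Operator

end BiLaplace

end

/-!
# Form methods for `a² Δ² + V²` on `L²(ℝ^N)`

*Reduction to an abstract statement.* On `C_c^∞(ℝ^N \ {0})` the Leibniz rule turns the first three
terms of the form into `Δu · Δ(a² v̄)`, and Green's identity then gives
`𝔞_λ(u,v) = ⟨(a² Δ² + V² + λ) u, v⟩` (`form_eq_inner`); all singularities sit at the origin, away
from the supports. Sesquilinearity and closability of a form `⟨L u, v⟩` come for free, so the
only analytic fact needed is that for one `λ = λ₀` the numerical range of `𝔞_λ` lies in the sector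
`|Im z| ≤ Re z` (`exists_form_mem_cone`).

*The sector estimate.* The lower order terms are bounded by
`(1/4) ∫ a²|Δu|² + c ∫ |x|^(2α-2)|∇u|² + c ∫ |x|^(2α-4)|u|²`. The identity
`∫ |x|^s |∇u|² = (s(s+N-2)/2) ∫ |x|^(s-2)|u|² - ∫ |x|^s Re(ū Δu)` (`integral_rpow_mul_gradSq`)
with `s = 2α - 2` reduces the gradient term to the other two, and with `s = -2` it gives Rellich's
inequality `∫ |x|⁻⁴|u|² ≤ ∫ |Δu|²`, where `N ≥ 5` is used (`rellich`). Since `-4 < 2α - 4 < 2β`, the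
weight `|x|^(2α-4)` is at most `ε|x|⁻⁴ + ε|x|^(2β) + C_ε`, hence form bounded with arbitrarily small
bound, and a large `λ₀` absorbs the remaining multiple of `‖u‖²`.

*From the form to the operator.* Polarization bounds a sectorial form by its form norm. The test
space is completed for the form norm to a Hilbert space `V`, to which the form and the embedding
into `L²` extend; the extended embedding is injective, which is closability
(`IsFormClosure.injective`), and the Lax–Milgram lemma makes the associated operator m-sectorial
(`IsFormClosure.isMSectorialGraph`).

*From the operator to the semigroup.* The Yosida approximations `Bₙ` of an m-sectorial operator
are commuting bounded operators with numerical range in the same sector, so `exp (-z Bₙ)` are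
contractions for `z` in it. They converge strongly, uniformly on bounded sets
(`exists_limit_expFamily`); the limit is strongly holomorphic, and by the Schwarz lemma holomorphic
in the operator norm. This is the generation theorem `IsMSectorialGraph.exists_semigroup`.
For `λ ≥ λ₀` the form norms are equivalent, so the operators differ by `λ - λ₀` and the semigroups by
the factor `exp (-(λ - λ₀) t)`.
-/

namespace BiLaplace

/-! ### Exponentials of bounded accretive operators -/

section BoundedAccretive

variable {H : Type*} [NormedAddCommGroup H] [InnerProductSpace ℂ H] [CompleteSpace H]

lemma norm_exp_neg_le_one {B : H →L[ℂ] H} (hB : ∀ x, 0 ≤ (inner ℂ x (B x)).re) :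
    ‖NormedSpace.exp (-B)‖ ≤ 1 := by
  refine ContinuousLinearMap.opNorm_le_bound _ zero_le_one fun x => ?_
  let U : ℝ → H := fun t => NormedSpace.exp (t • (-B)) x
  have hU : ∀ t, HasDerivAt U (-(B (U t))) t := fun t => by
    have h := (hasDerivAt_exp_smul_const' (𝕂 := ℝ) (-B) t)
    have h2 := ((ContinuousLinearMap.apply ℂ H x).restrictScalars ℝ).hasFDerivAt.comp_hasDerivAt t h
    simpa [U, Function.comp_def] using h2
  have hd : ∀ t, HasDerivAt (fun t => (inner ℂ (U t) (U t)).re)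
      (-(2 * (inner ℂ (U t) (B (U t))).re)) t := fun t => by
    have h := (hU t).inner ℂ (hU t)
    have h2 := Complex.reCLM.hasFDerivAt.comp_hasDerivAt t h
    refine h2.congr_deriv ?_
    simp only [inner_neg_right, inner_neg_left, Complex.reCLM_apply, Complex.add_re,
      Complex.neg_re]
    have : (inner ℂ (B (U t)) (U t)).re = (inner ℂ (U t) (B (U t))).re :=
      inner_re_symm (𝕜 := ℂ) _ _
    linarith
  have hanti := antitone_of_hasDerivAt_nonpos hd (fun t => by
    have := hB (U t); simp only [Pi.zero_apply]; linarith)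
  have h01 := hanti (zero_le_one)
  have e : ∀ t, (inner ℂ (U t) (U t)).re = ‖U t‖ ^ 2 := fun t => inner_self_eq_norm_sq (𝕜 := ℂ) _
  simp only [e] at h01
  have h0 : U 0 = x := by simp [U]
  have h1 : U 1 = NormedSpace.exp (-B) x := by simp [U]
  rw [h0, h1] at h01
  rw [one_mul]
  exact (pow_le_pow_iff_left₀ (norm_nonneg _) (norm_nonneg _) two_ne_zero).1 h01

/-- Duhamel's formula in the form of an estimate. -/
lemma norm_exp_neg_sub_exp_neg_le {P Q : H →L[ℂ] H} (hP : ∀ x, 0 ≤ (inner ℂ x (P x)).re)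
    (hQ : ∀ x, 0 ≤ (inner ℂ x (Q x)).re) (hc : Commute P Q) (x : H) :
    ‖NormedSpace.exp (-P) x - NormedSpace.exp (-Q) x‖ ≤ ‖P x - Q x‖ := by
  -- interpolate by `exp (-(t P + (1 - t) Q))`, whose derivative in `t` is that operator
  -- times `Q - P`
  let f : ℝ → H := fun t => NormedSpace.exp (-Q + t • (Q - P)) x
  have hcomm : ∀ t : ℝ, NormedSpace.exp (-Q + t • (Q - P))
      = NormedSpace.exp (-Q) * NormedSpace.exp (t • (Q - P)) := fun t => by
    let : NormedAlgebra ℚ (H →L[ℂ] H) := NormedAlgebra.restrictScalars ℚ ℂ _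
    refine NormedSpace.exp_add_of_commute (Commute.neg_left (Commute.smul_right ?_ t))
    exact (Commute.refl Q).sub_right hc.symm
  have hf : ∀ t, HasDerivAt f (NormedSpace.exp (-Q + t • (Q - P)) (Q x - P x)) t := fun t => by
    have h := (hasDerivAt_exp_smul_const (𝕂 := ℝ) (Q - P) t).const_mul (NormedSpace.exp (-Q))
    have h2 := ((ContinuousLinearMap.apply ℂ H x).restrictScalars ℝ).hasFDerivAt.comp_hasDerivAt t h
    rw [hcomm]
    have : f = fun t => (NormedSpace.exp (-Q) * NormedSpace.exp (t • (Q - P))) x := by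
      funext t; simp only [f, hcomm]
    rw [this]
    simpa [mul_assoc, Function.comp_def] using h2
  have hb := norm_image_sub_le_of_norm_deriv_le_segment_01' (f := f) (C := ‖P x - Q x‖)
    (fun t _ => (hf t).hasDerivWithinAt) (fun t ht => by
      have e : -Q + t • (Q - P) = -((1 - t) • Q + t • P) := by module
      have hn : ‖NormedSpace.exp (-Q + t • (Q - P))‖ ≤ 1 := by
        rw [e]
        refine norm_exp_neg_le_one fun y => ?_
        have e1 : ∀ (r : ℝ) (B : H →L[ℂ] H), (inner ℂ y ((r • B) y)).re
            = r * (inner ℂ y (B y)).re := fun r B => by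
          rw [smul_apply, ← Complex.coe_smul, inner_smul_right,
            Complex.re_ofReal_mul]
        rw [add_apply, inner_add_right, Complex.add_re, e1, e1]
        have := hP y; have := hQ y; have := ht.1; have := ht.2
        have : 0 ≤ 1 - t := by linarith
        positivity
      refine (ContinuousLinearMap.le_opNorm _ _).trans ?_
      rw [norm_sub_rev (P x)]
      exact mul_le_of_le_one_left (norm_nonneg _) hn)
  have e : -Q + (Q - P) = -P := by abel
  simpa [f, e] using hb

/-- The closed sector `|Im z| ≤ Re z`. -/
def cone : Set ℂ := {z | |z.im| ≤ z.re}

lemma zero_mem_cone : (0 : ℂ) ∈ cone := by simp [cone]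

lemma add_mem_cone {z w : ℂ} (hz : z ∈ cone) (hw : w ∈ cone) : z + w ∈ cone := by
  simp only [cone, Set.mem_ofPred_eq, Complex.add_im, Complex.add_re] at *
  exact (abs_add_le _ _).trans (add_le_add hz hw)

lemma ofReal_mem_cone {t : ℝ} (ht : 0 ≤ t) : (t : ℂ) ∈ cone := by simpa [cone] using ht

lemma re_mul_nonneg_of_mem_cone {z w : ℂ} (hz : z ∈ cone) (hw : w ∈ cone) : 0 ≤ (z * w).re := by
  simp only [cone, Set.mem_ofPred_eq] at *
  rw [Complex.mul_re]
  have h1 : z.im * w.im ≤ |z.im| * |w.im| := by rw [← abs_mul]; exact le_abs_self _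
  have h2 := mul_le_mul hz hw (abs_nonneg _) ((abs_nonneg _).trans hz)
  linarith

lemma sector_subset_cone : sector (Real.pi / 4) ⊆ cone := by
  rintro z ⟨-, hz⟩
  have hpi := Real.pi_pos
  have h0 := abs_nonneg z.arg
  have hs : |Real.sin z.arg| ≤ Real.cos z.arg := by
    rw [Real.abs_sin_eq_sin_abs_of_abs_le_pi (by linarith), ← Real.cos_abs z.arg,
      ← Real.sin_pi_div_two_sub]
    exact Real.sin_le_sin_of_le_of_le_pi_div_two (by linarith) (by linarith) (by linarith)
  simp only [cone, Set.mem_ofPred_eq]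
  rw [← Complex.norm_mul_cos_arg, ← Complex.norm_mul_sin_arg, abs_mul, abs_norm]
  exact mul_le_mul_of_nonneg_left hs (norm_nonneg _)

lemma isOpen_sector {θ : ℝ} (hθ : θ ≤ Real.pi / 2) : IsOpen (sector θ) := by
  rw [isOpen_iff_mem_nhds]
  rintro z ⟨hz0, hz⟩
  have hre : z ∈ Complex.slitPlane := by
    rw [Complex.mem_slitPlane_iff_arg]
    refine ⟨fun h => ?_, hz0⟩
    rw [h, abs_of_pos Real.pi_pos] at hz
    linarith [Real.pi_pos]
  filter_upwards [(Complex.continuousAt_arg hre).abs.eventually_lt continuousAt_const hz,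
    isOpen_compl_singleton.mem_nhds (Set.mem_compl_singleton_iff.2 hz0)] with w h1 h2
  exact ⟨h2, h1⟩

end BoundedAccretive

/-! ### Strong limits of exponentials of sectorial operators -/

section ExponentialLimit

variable {H : Type*} [NormedAddCommGroup H] [InnerProductSpace ℂ H] [CompleteSpace H]

/-- The bounded operator `B` is sectorial with half-angle `π/4`: its numerical range lies in the
cone `|Im z| ≤ Re z`. -/
def IsSectorialOp (B : H →L[ℂ] H) : Prop := ∀ x, inner ℂ x (B x) ∈ cone

/-- The entire family `z ↦ exp (-z B)`. -/
noncomputable def expFamily (B : H →L[ℂ] H) (z : ℂ) : H →L[ℂ] H := NormedSpace.exp (-(z • B))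

omit [CompleteSpace H] in
lemma IsSectorialOp.re_smul_nonneg {B : H →L[ℂ] H} (hB : IsSectorialOp B) {z : ℂ} (hz : z ∈ cone)
    (x : H) : 0 ≤ (inner ℂ x ((z • B) x)).re := by
  rw [smul_apply, inner_smul_right]
  exact re_mul_nonneg_of_mem_cone hz (hB x)

lemma IsSectorialOp.norm_expFamily_le {B : H →L[ℂ] H} (hB : IsSectorialOp B) {z : ℂ}
    (hz : z ∈ cone) : ‖expFamily B z‖ ≤ 1 :=
  norm_exp_neg_le_one (hB.re_smul_nonneg hz)

lemma IsSectorialOp.norm_expFamily_apply_le {B : H →L[ℂ] H} (hB : IsSectorialOp B) {z : ℂ}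
    (hz : z ∈ cone) (x : H) : ‖expFamily B z x‖ ≤ ‖x‖ := by
  simpa using (expFamily B z).le_of_opNorm_le (hB.norm_expFamily_le hz) x

lemma IsSectorialOp.norm_expFamily_sub_le {B C : H →L[ℂ] H} (hB : IsSectorialOp B)
    (hC : IsSectorialOp C) (hBC : Commute B C) {z : ℂ} (hz : z ∈ cone) (x : H) :
    ‖expFamily B z x - expFamily C z x‖ ≤ ‖z‖ * ‖B x - C x‖ := by
  refine (norm_exp_neg_sub_exp_neg_le (hB.re_smul_nonneg hz) (hC.re_smul_nonneg hz)
    ((hBC.smul_left z).smul_right z) x).trans (le_of_eq ?_)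
  rw [smul_apply, smul_apply, ← smul_sub, norm_smul]

lemma hasDerivAt_expFamily (B : H →L[ℂ] H) (z : ℂ) :
    HasDerivAt (expFamily B) (-(expFamily B z * B)) z := by
  have h := hasDerivAt_exp_smul_const (𝕂 := ℂ) (-B) z
  have e : expFamily B = fun u => NormedSpace.exp (u • -B) := by
    funext u; rw [expFamily, smul_neg]
  rw [e]
  simpa using h

lemma hasDerivAt_expFamily_apply (B : H →L[ℂ] H) (x : H) (z : ℂ) :
    HasDerivAt (fun z => expFamily B z x) (-(expFamily B z (B x))) z := by
  have h := (ContinuousLinearMap.apply ℂ H x).hasFDerivAt.comp_hasDerivAt z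
    (hasDerivAt_expFamily B z)
  simpa [Function.comp_def] using h

lemma expFamily_add (B : H →L[ℂ] H) (z w : ℂ) :
    expFamily B (z + w) = expFamily B z * expFamily B w := by
  let : NormedAlgebra ℚ (H →L[ℂ] H) := NormedAlgebra.restrictScalars ℚ ℂ _
  rw [expFamily, add_smul, neg_add]
  exact NormedSpace.exp_add_of_commute
    (((Commute.refl B).smul_left z).smul_right w).neg_left.neg_right

/-- `S` is the strong limit of `exp (-z Bₙ)`, uniformly on bounded subsets of the cone. -/
def IsExpLimit (B : ℕ → H →L[ℂ] H) (S : ℂ → H →L[ℂ] H) : Prop :=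
  ∀ (x : H) (r : ℝ), TendstoUniformlyOn (fun n z => expFamily (B n) z x)
      (fun z => S z x) atTop (cone ∩ Metric.closedBall 0 r)

/-- Commuting sectorial operators that converge strongly on a dense set have strongly convergent
exponentials, uniformly on bounded subsets of the cone. -/
lemma exists_limit_expFamily {B : ℕ → H →L[ℂ] H} (hB : ∀ n, IsSectorialOp (B n))
    (hc : ∀ m n, Commute (B m) (B n))
    (hd : Dense {u | ∃ g, Tendsto (fun n => B n u) atTop (𝓝 g)}) :
    ∃ S : ℂ → H →L[ℂ] H, IsExpLimit B S := by
  have hcau : ∀ (x : H) (r : ℝ), UniformCauchySeqOn (fun n z => expFamily (B n) z x) atTop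
      (cone ∩ Metric.closedBall 0 r) := by
    intro x r
    rw [Metric.uniformCauchySeqOn_iff]
    intro ε hε
    obtain ⟨u, hu, g, hg⟩ := Metric.dense_iff.1 hd x (ε / 4) (by positivity)
    rw [Metric.mem_ball, dist_eq_norm] at hu
    obtain ⟨K, hK⟩ := Metric.cauchySeq_iff.1 hg.cauchySeq (ε / (4 * (|r| + 1))) (by positivity)
    refine ⟨K, fun m hm n hn z hz => ?_⟩
    have h1 : ∀ k, ‖expFamily (B k) z (u - x)‖ < ε / 4 := fun k =>
      ((hB k).norm_expFamily_apply_le hz.1 _).trans_lt hu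
    have h2 := (hB m).norm_expFamily_sub_le (hB n) (hc m n) hz.1 u
    have h3 : ‖z‖ ≤ |r| + 1 := by
      have := hz.2; rw [mem_closedBall_zero_iff] at this
      linarith [le_abs_self r]
    have h4 := hK m hm n hn
    rw [dist_eq_norm, lt_div_iff₀ (by positivity)] at h4
    have h5 : ‖z‖ * ‖B m u - B n u‖ ≤ ε / 4 := by
      have := mul_le_mul_of_nonneg_right h3 (norm_nonneg (B m u - B n u))
      linarith
    rw [dist_eq_norm]
    have e : expFamily (B m) z x - expFamily (B n) z x
        = (expFamily (B m) z u - expFamily (B n) z u)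
          - (expFamily (B m) z (u - x) - expFamily (B n) z (u - x)) := by
      simp only [map_sub]; abel
    rw [e]
    have := norm_sub_le (expFamily (B m) z u - expFamily (B n) z u)
      (expFamily (B m) z (u - x) - expFamily (B n) z (u - x))
    have := norm_sub_le (expFamily (B m) z (u - x)) (expFamily (B n) z (u - x))
    linarith [h1 m, h1 n]
  have hlim : ∀ z, ∃ T : H →L[ℂ] H, z ∈ cone →
      ∀ x, Tendsto (fun n => expFamily (B n) z x) atTop (𝓝 (T x)) := by
    intro z
    by_cases hz : z ∈ cone
    · have : ∀ x, ∃ y, Tendsto (fun n => expFamily (B n) z x) atTop (𝓝 y) := fun x =>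
        cauchySeq_tendsto_of_complete ((hcau x ‖z‖).cauchySeq ⟨hz, by simp⟩)
      choose f hf using this
      exact ⟨continuousLinearMapOfTendsto (fun n => expFamily (B n) z) (tendsto_pi_nhds.2 hf),
        fun _ x => hf x⟩
    · exact ⟨0, fun h => absurd h hz⟩
  choose S hS using hlim
  exact ⟨S, fun x r => (hcau x r).tendstoUniformlyOn_of_tendsto fun z hz => hS z hz.1 x⟩

namespace IsExpLimit

variable {B : ℕ → H →L[ℂ] H} {S : ℂ → H →L[ℂ] H}

lemma tendsto (hS : IsExpLimit B S) {z : ℂ} (hz : z ∈ cone) (x : H) :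
    Tendsto (fun n => expFamily (B n) z x) atTop (𝓝 (S z x)) :=
  (hS x ‖z‖).tendsto_at ⟨hz, by simp⟩

lemma norm_apply_le (hS : IsExpLimit B S) (hB : ∀ n, IsSectorialOp (B n)) {z : ℂ}
    (hz : z ∈ cone) (x : H) : ‖S z x‖ ≤ ‖x‖ :=
  le_of_tendsto (hS.tendsto hz x).norm
    (Eventually.of_forall fun n => (hB n).norm_expFamily_apply_le hz x)

lemma norm_le_one (hS : IsExpLimit B S) (hB : ∀ n, IsSectorialOp (B n)) {z : ℂ}
    (hz : z ∈ cone) : ‖S z‖ ≤ 1 :=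
  ContinuousLinearMap.opNorm_le_bound _ zero_le_one fun x => by
    simpa using hS.norm_apply_le hB hz x

lemma map_zero (hS : IsExpLimit B S) : S 0 = 1 := by
  ext x
  refine tendsto_nhds_unique (hS.tendsto zero_mem_cone x) ?_
  simp [expFamily]

lemma map_add (hS : IsExpLimit B S) (hB : ∀ n, IsSectorialOp (B n)) {z w : ℂ}
    (hz : z ∈ cone) (hw : w ∈ cone) : S (z + w) = S z * S w := by
  ext x
  refine tendsto_nhds_unique (hS.tendsto (add_mem_cone hz hw) x) ?_
  have h1 : Tendsto (fun n => expFamily (B n) z (expFamily (B n) w x - S w x)) atTop (𝓝 0) := by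
    refine squeeze_zero_norm (fun n => (hB n).norm_expFamily_apply_le hz _) ?_
    have := (hS.tendsto hw x).sub_const (S w x)
    rw [sub_self] at this
    simpa using this.norm
  have h2 := h1.add (hS.tendsto hz (S w x))
  rw [zero_add] at h2
  refine h2.congr fun n => ?_
  rw [expFamily_add, map_sub, sub_add_cancel]
  rfl

lemma continuousOn (hS : IsExpLimit B S) (x : H) : ContinuousOn (fun z => S z x) cone := by
  intro z hz
  have h : ContinuousOn (fun z => S z x) (cone ∩ Metric.closedBall 0 (‖z‖ + 1)) :=
    (hS x _).continuousOn (Frequently.of_forall fun n w _ =>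
      (hasDerivAt_expFamily_apply (B n) x w).continuousAt.continuousWithinAt)
  refine ((h z ⟨hz, by simp⟩).mono_of_mem_nhdsWithin ?_)
  refine inter_mem_nhdsWithin _ (Metric.closedBall_mem_nhds_of_mem ?_)
  simp

lemma differentiableOn_apply (hS : IsExpLimit B S) (x : H) :
    DifferentiableOn ℂ (fun z => S z x) (sector (Real.pi / 4)) := by
  have hopen := isOpen_sector (θ := Real.pi / 4) (by linarith [Real.pi_pos])
  have h : TendstoLocallyUniformlyOn (fun n z => expFamily (B n) z x) (fun z => S z x) atTop
      (sector (Real.pi / 4)) := by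
    rw [tendstoLocallyUniformlyOn_iff_forall_isCompact hopen]
    intro K hK hKc
    obtain ⟨r, hr⟩ := hKc.isBounded.subset_closedBall (0 : ℂ)
    exact (hS x r).mono (Set.subset_inter (hK.trans sector_subset_cone) hr)
  exact h.differentiableOn (Eventually.of_forall fun n z _ =>
    (hasDerivAt_expFamily_apply (B n) x z).differentiableAt.differentiableWithinAt) hopen

end IsExpLimit

/-- A family of contractions that is strongly holomorphic on an open set is holomorphic in the
operator norm: by the Schwarz lemma the second order Taylor remainder is bounded uniformly on the
unit ball of `H`. -/
lemma differentiableOn_of_strongly_differentiableOn {S : ℂ → H →L[ℂ] H} {U : Set ℂ}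
    (hU : IsOpen U) (hd : ∀ x, DifferentiableOn ℂ (fun z => S z x) U) (hb : ∀ z ∈ U, ‖S z‖ ≤ 1) :
    DifferentiableOn ℂ S U := by
  intro c hc
  obtain ⟨r, hr, hrU⟩ := Metric.isOpen_iff.1 hU c hc
  have hSx : ∀ z ∈ U, ∀ x, ‖S z x‖ ≤ ‖x‖ := fun z hz x => by
    simpa using (S z).le_of_opNorm_le (hb z hz) x
  have hmaps : ∀ x, Set.MapsTo (fun z => S z x) (Metric.ball c r)
      (Metric.closedBall (S c x) (2 * ‖x‖)) := fun x z hz => by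
    rw [Metric.mem_closedBall, dist_eq_norm]
    have := norm_sub_le (S z x) (S c x)
    linarith [hSx z (hrU hz) x, hSx c hc x]
  have hder : ∀ x, HasDerivAt (fun z => S z x) (deriv (fun z => S z x) c) c := fun x =>
    ((hd x).differentiableAt (hU.mem_nhds hc)).hasDerivAt
  have hDn : ∀ x, ‖deriv (fun z => S z x) c‖ ≤ 2 / r * ‖x‖ := fun x => by
    have := Complex.norm_deriv_le_div_of_mapsTo_ball ((hd x).mono hrU) (hmaps x) hr
    rwa [mul_div_right_comm] at this
  let D : H →L[ℂ] H := LinearMap.mkContinuous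
    { toFun := fun x => deriv (fun z => S z x) c
      map_add' := fun x y => by
        simpa only [_root_.map_add] using! ((hder x).add (hder y)).deriv
      map_smul' := fun a x => by
        simpa only [_root_.map_smul] using! ((hder x).const_smul a).deriv } (2 / r) hDn
  have hD : ∀ x, D x = deriv (fun z => S z x) c := fun x => rfl
  have key : ∀ z ∈ Metric.ball c r, ‖S z - S c - (z - c) • D‖ ≤ 4 / r ^ 2 * ‖z - c‖ ^ 2 := by
    intro z hz
    refine ContinuousLinearMap.opNorm_le_bound _ (by positivity) fun x => ?_
    let F : ℂ → H := fun w => S w x - (w - c) • D x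
    have hF : DifferentiableOn ℂ F (Metric.ball c r) := by
      refine ((hd x).mono hrU).sub (DifferentiableOn.smul_const ?_ _)
      fun_prop
    have hFc : F c = S c x := by simp [F]
    have hFm : Set.MapsTo F (Metric.ball c r) (Metric.closedBall (F c) (4 * ‖x‖)) := by
      intro w hw
      rw [Metric.mem_closedBall, dist_eq_norm, hFc]
      have h1 := hmaps x hw
      rw [Metric.mem_closedBall, dist_eq_norm] at h1
      have h2 : ‖(w - c) • D x‖ ≤ 2 * ‖x‖ := by
        rw [norm_smul, hD]
        have hw' : ‖w - c‖ ≤ r := by rw [← dist_eq_norm]; exact (Metric.mem_ball.1 hw).le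
        calc _ ≤ r * (2 / r * ‖x‖) := mul_le_mul hw' (hDn x) (norm_nonneg _) hr.le
          _ = _ := by field_simp
      have e : F w - S c x = (S w x - S c x) - (w - c) • D x := by simp only [F]; abel
      rw [e]
      linarith [norm_sub_le (S w x - S c x) ((w - c) • D x)]
    have ho : (fun w => F w - F c) =o[𝓝 c] fun w => ‖w - c‖ ^ 1 := by
      have := (hasDerivAt_iff_isLittleO.1 (hder x)).norm_right
      simp only [pow_one]
      refine this.congr_left fun w => ?_
      rw [hFc]; simp only [F, hD]; abel
    have h := Complex.dist_le_mul_div_pow_of_mapsTo_ball_of_isLittleO hF hFm ho hz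
    rw [dist_eq_norm, dist_eq_norm, hFc] at h
    have e : (S z - S c - (z - c) • D) x = F z - S c x := by
      simp only [F, sub_apply, smul_apply]; abel
    rw [e]
    refine h.trans (le_of_eq ?_)
    ring
  have : HasDerivAt S D c := by
    rw [hasDerivAt_iff_isLittleO]
    have hO : (fun z => S z - S c - (z - c) • D) =O[𝓝 c] fun z => ‖z - c‖ ^ 2 := by
      refine Asymptotics.IsBigO.of_bound (4 / r ^ 2) ?_
      filter_upwards [Metric.ball_mem_nhds c hr] with z hz
      simpa using key z hz
    refine hO.trans_isLittleO ?_
    have h0 : Tendsto (fun z => z - c) (𝓝 c) (𝓝 0) := by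
      exact Continuous.tendsto' (by fun_prop) _ _ (sub_self c)
    have h1 := (Asymptotics.isLittleO_norm_pow_id (E' := ℂ) one_lt_two).comp_tendsto h0
    exact h1
  exact this.differentiableAt.differentiableWithinAt

namespace IsExpLimit

variable {B : ℕ → H →L[ℂ] H} {S : ℂ → H →L[ℂ] H}

/-- On the vectors where the `B n` converge, the limit semigroup is differentiable at `0`, with
derivative minus the limit of the `B n`. -/
lemma tendsto_slope (hS : IsExpLimit B S) (hB : ∀ n, IsSectorialOp (B n)) {u g : H}
    (hg : Tendsto (fun n => B n u) atTop (𝓝 g)) :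
    Tendsto (fun t : ℝ => ((t⁻¹ : ℝ) : ℂ) • (S t u - u)) (𝓝[>] 0) (𝓝 (-g)) := by
  rw [Metric.tendsto_nhdsWithin_nhds]
  intro ε hε
  have hcont : ContinuousWithinAt (fun t : ℝ => S t g) (Set.Ici 0) 0 := by
    refine ContinuousWithinAt.comp (t := cone) (f := fun t : ℝ => (t : ℂ)) (g := fun z => S z g)
      ?_ Complex.continuous_ofReal.continuousWithinAt fun t ht => ofReal_mem_cone ht
    simpa using hS.continuousOn g 0 zero_mem_cone
  obtain ⟨δ, hδ, hδS⟩ := Metric.continuousWithinAt_iff.1 hcont (ε / 8) (by positivity)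
  refine ⟨min δ 1, by positivity, fun t (ht : 0 < t) htd => ?_⟩
  rw [dist_zero_right, Real.norm_of_nonneg ht.le, lt_min_iff] at htd
  have hbound : ‖S t u - u + (t : ℂ) • g‖ ≤ ε / 2 * t := by
    have hlim : Tendsto (fun n => expFamily (B n) t u - u + (t : ℂ) • B n u) atTop
        (𝓝 (S t u - u + (t : ℂ) • g)) :=
      ((hS.tendsto (ofReal_mem_cone ht.le) u).sub_const u).add (hg.const_smul _)
    refine le_of_tendsto hlim.norm ?_
    filter_upwards [Metric.tendstoUniformlyOn_iff.1 (hS g 1) (ε / 8) (by positivity),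
      Metric.tendsto_nhds.1 hg (ε / 8) (by positivity)] with n hn1 hn2
    have hf : ∀ s : ℝ, HasDerivAt (fun s : ℝ => expFamily (B n) s u + (s : ℂ) • B n u)
        (-(expFamily (B n) s (B n u)) + B n u) s := fun s => by
      have h0 : HasDerivAt (fun r : ℝ => (r : ℂ)) 1 s := Complex.ofRealCLM.hasDerivAt
      have h1 := (hasDerivAt_expFamily_apply (B n) u s).scomp s h0
      have h2 := h0.smul_const (B n u)
      simpa using! h1.add h2
    have hm := norm_image_sub_le_of_norm_deriv_le_segment' (a := 0) (b := t) (C := ε / 2)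
      (fun s _ => (hf s).hasDerivWithinAt) (fun s hs => ?_) t (Set.right_mem_Icc.2 ht.le)
    · have e : expFamily (B n) t u - u + (t : ℂ) • B n u
        = expFamily (B n) t u + (t : ℂ) • B n u
          - (expFamily (B n) (0 : ℝ) u + ((0 : ℝ) : ℂ) • B n u) := by
        simp [expFamily]; abel
      rw [e]
      simpa using hm
    · have hsc := ofReal_mem_cone hs.1
      have h1 : ‖S s g - expFamily (B n) s g‖ < ε / 8 := by
        rw [← dist_eq_norm]
        refine hn1 s ⟨hsc, ?_⟩
        rw [mem_closedBall_zero_iff, Complex.norm_real, Real.norm_of_nonneg hs.1]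
        linarith [hs.2]
      have h2 : ‖S s g - g‖ < ε / 8 := by
        have := hδS (x := s) hs.1 (by
          rw [dist_zero_right, Real.norm_of_nonneg hs.1]; linarith [hs.2])
        rw [dist_eq_norm] at this
        simpa [hS.map_zero] using this
      have h3 : ‖B n u - g‖ < ε / 8 := by rwa [← dist_eq_norm]
      have h4 := ((hB n).norm_expFamily_apply_le hsc (B n u - g)).trans_lt h3
      have e : -(expFamily (B n) s (B n u)) + B n u = (B n u - g) - expFamily (B n) s (B n u - g)
          - (S s g - g) + (S s g - expFamily (B n) s g) := by
        rw [map_sub]; abel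
      rw [e]
      refine (norm_add_le _ _).trans ?_
      have := norm_sub_le (B n u - g - expFamily (B n) s (B n u - g)) (S s g - g)
      have := norm_sub_le (B n u - g) (expFamily (B n) s (B n u - g))
      linarith
  have htc : (t : ℂ) ≠ 0 := by exact_mod_cast ht.ne'
  have e : ((t⁻¹ : ℝ) : ℂ) • (S t u - u) - -g = ((t⁻¹ : ℝ) : ℂ) • (S t u - u + (t : ℂ) • g) := by
    rw [smul_add, smul_smul, Complex.ofReal_inv, inv_mul_cancel₀ htc, one_smul, sub_neg_eq_add]
  rw [dist_eq_norm, e, norm_smul, Complex.norm_real, norm_inv, Real.norm_of_nonneg ht.le]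
  calc t⁻¹ * _ ≤ t⁻¹ * (ε / 2 * t) := by gcongr
    _ = ε / 2 := by field_simp
    _ < ε := by linarith

lemma isAnalyticContractionSemigroup (hS : IsExpLimit B S) (hB : ∀ n, IsSectorialOp (B n)) :
    IsAnalyticContractionSemigroup fun t : ℝ => S t := by
  refine ⟨⟨by simpa using hS.map_zero, fun s t hs ht => ?_, fun x => ?_⟩, fun t ht =>
    hS.norm_le_one hB (ofReal_mem_cone ht), Real.pi / 4, S, ⟨by positivity, by linarith [Real.pi_pos],
    fun _ _ => rfl, fun z hz w hw => ?_, ?_, fun θ' h0 h1 x => ?_⟩, fun z hz =>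
    hS.norm_le_one hB (sector_subset_cone hz)⟩
  · simpa using hS.map_add hB (ofReal_mem_cone hs) (ofReal_mem_cone ht)
  · exact (hS.continuousOn x).comp Complex.continuous_ofReal.continuousOn
      fun t ht => ofReal_mem_cone ht
  · exact hS.map_add hB (sector_subset_cone hz) (sector_subset_cone hw)
  · exact differentiableOn_of_strongly_differentiableOn
      (isOpen_sector (by linarith [Real.pi_pos])) hS.differentiableOn_apply
      fun z hz => hS.norm_le_one hB (sector_subset_cone hz)
  · have h : Tendsto (fun z => S z x) (𝓝[cone] 0) (𝓝 (S 0 x)) := hS.continuousOn x 0 zero_mem_cone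
    rw [hS.map_zero] at h
    refine h.mono_left (nhdsWithin_mono _ (Set.Subset.trans ?_ sector_subset_cone))
    exact fun z hz => ⟨hz.1, hz.2.trans h1⟩

end IsExpLimit

end ExponentialLimit

/-! ### Yosida approximation and the generation theorem -/

section Generation

variable {H : Type*} [NormedAddCommGroup H] [InnerProductSpace ℂ H]

/-- The graph of a densely defined m-sectorial operator with half-angle `π/4`: the numerical range
`⟨A u, u⟩` lies in the cone `|Im z| ≤ Re z`, and `A + μ` is onto for all `μ > 0`. -/
structure IsMSectorialGraph (G : Submodule ℂ (H × H)) : Prop where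
  inner_mem : ∀ u f, (u, f) ∈ G → inner ℂ u f ∈ cone
  exists_resolvent : ∀ μ : ℝ, 0 < μ → ∀ f, ∃ u, (u, f - (μ : ℂ) • u) ∈ G
  dense_domain : Dense {u | ∃ f, (u, f) ∈ G}

namespace IsMSectorialGraph

variable {G : Submodule ℂ (H × H)}

lemma norm_le (hG : IsMSectorialGraph G) {μ : ℝ} {u f : H}
    (h : (u, f - (μ : ℂ) • u) ∈ G) : μ * ‖u‖ ≤ ‖f‖ := by
  have h1 : 0 ≤ (inner ℂ u (f - (μ : ℂ) • u)).re := (abs_nonneg _).trans (hG.inner_mem _ _ h)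
  rw [inner_sub_right, inner_smul_right, Complex.sub_re, Complex.re_ofReal_mul] at h1
  have h2 : (inner ℂ u u).re = ‖u‖ ^ 2 := inner_self_eq_norm_sq (𝕜 := ℂ) u
  have h3 : (inner ℂ u f).re ≤ ‖u‖ * ‖f‖ := re_inner_le_norm (𝕜 := ℂ) u f
  rw [h2] at h1
  rcases (norm_nonneg u).eq_or_lt with h0 | h0
  · rw [← h0]; simp
  · refine le_of_mul_le_mul_left ?_ h0
    nlinarith

lemma eq_of_mem (hG : IsMSectorialGraph G) {μ : ℝ} (hμ : 0 < μ) {u v f : H}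
    (hu : (u, f - (μ : ℂ) • u) ∈ G) (hv : (v, f - (μ : ℂ) • v) ∈ G) : u = v := by
  have h := G.sub_mem hu hv
  have h' : (u - v, (0 : H) - (μ : ℂ) • (u - v)) ∈ G := by
    convert h using 1
    simp only [Prod.mk_sub_mk, Prod.mk.injEq, true_and]
    module
  have := hG.norm_le h'
  rw [norm_zero] at this
  have h0 : ‖u - v‖ = 0 := le_antisymm (by
    by_contra hc; push Not at hc; nlinarith) (norm_nonneg _)
  exact sub_eq_zero.1 (norm_eq_zero.1 h0)

lemma exists_resolventCLM (hG : IsMSectorialGraph G) {μ : ℝ} (hμ : 0 < μ) :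
    ∃ R : H →L[ℂ] H, ∀ f, (R f, f - (μ : ℂ) • R f) ∈ G := by
  choose R hR using hG.exists_resolvent μ hμ
  refine ⟨LinearMap.mkContinuous
    { toFun := R
      map_add' := fun f g => hG.eq_of_mem hμ (hR _) ?_
      map_smul' := fun a f => hG.eq_of_mem hμ (hR _) ?_ } μ⁻¹ fun f => ?_, hR⟩
  · convert G.add_mem (hR f) (hR g) using 1
    simp only [Prod.mk_add_mk, Prod.mk.injEq, true_and]
    module
  · convert G.smul_mem a (hR f) using 1
    simp only [RingHom.id_apply, Prod.smul_mk, Prod.mk.injEq, true_and]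
    module
  · rw [le_inv_mul_iff₀ hμ]
    exact hG.norm_le (hR f)

/-- The Yosida approximations `n (1 - n (n + A)⁻¹)`. -/
lemma exists_yosida (hG : IsMSectorialGraph G) :
    ∃ B : ℕ → H →L[ℂ] H, (∀ n, IsSectorialOp (B n)) ∧ (∀ m n, Commute (B m) (B n)) ∧
      ∀ u g, (u, g) ∈ G → Tendsto (fun n => B n u) atTop (𝓝 g) := by
  have hpos : ∀ n : ℕ, (0 : ℝ) < n + 1 := fun n => by positivity
  choose R hR using fun n : ℕ => hG.exists_resolventCLM (hpos n)
  have hR_mem : ∀ n u g, (u, g) ∈ G → R n (g + ((n + 1 : ℝ) : ℂ) • u) = u := fun n u g h =>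
    hG.eq_of_mem (hpos n) (hR n _) (by simpa using h)
  have hRn : ∀ (n : ℕ) g, (n + 1 : ℝ) * ‖R n g‖ ≤ ‖g‖ := fun n g => hG.norm_le (hR n g)
  -- the resolvent equation
  have hres : ∀ m n : ℕ, ∀ f, R m f - R n f = ((n : ℂ) - m) • R m (R n f) := fun m n f => by
    have h := hR_mem m _ _ (hR n f)
    have e : f - ((n + 1 : ℝ) : ℂ) • R n f + ((m + 1 : ℝ) : ℂ) • R n f
        = f - ((n : ℂ) - m) • R n f := by push_cast; module
    rw [e, map_sub, _root_.map_smul] at h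
    rw [sub_eq_iff_eq_add] at h ⊢
    rw [h]; abel
  have hcomm : ∀ m n, Commute (R m) (R n) := fun m n => by
    rcases eq_or_ne m n with rfl | hmn
    · exact Commute.refl _
    · ext f
      have h1 := hres m n f
      have h2 := hres n m f
      have h3 : ((n : ℂ) - m) • R m (R n f) = ((n : ℂ) - m) • R n (R m f) := by
        rw [← h1, ← neg_sub, h2, ← neg_smul, neg_sub]
      refine smul_right_injective H (sub_ne_zero.2 ?_) h3
      exact_mod_cast hmn.symm
  let B : ℕ → H →L[ℂ] H := fun n => ((n + 1 : ℝ) : ℂ) • (1 - ((n + 1 : ℝ) : ℂ) • R n)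
  have hBf : ∀ n f, B n f = ((n + 1 : ℝ) : ℂ) • (f - ((n + 1 : ℝ) : ℂ) • R n f) := fun n f => rfl
  refine ⟨B, fun n f => ?_, fun m n => ?_, fun u g h => ?_⟩
  · -- `f = v + n⁻¹ A v` with `v = n (n + A)⁻¹ f`, so `⟨A v, f⟩ = ⟨A v, v⟩ + n⁻¹ ‖A v‖²`
    set w := f - ((n + 1 : ℝ) : ℂ) • R n f with hw
    have e : f = ((n + 1 : ℝ) : ℂ) • R n f + w := by rw [hw]; abel
    have h1 := hG.inner_mem _ _ (hR n f)
    have hn := hpos n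
    rw [hBf, ← hw]
    nth_rewrite 1 [e]
    rw [inner_smul_right, inner_add_left, inner_smul_left, Complex.conj_ofReal,
      inner_self_eq_norm_sq_to_K, ← hw] at *
    simp only [cone, Set.mem_ofPred_eq] at h1 ⊢
    have e2 : ((‖w‖ : ℂ)) ^ 2 = ((‖w‖ ^ 2 : ℝ) : ℂ) := by push_cast; rfl
    rw [Complex.im_ofReal_mul, Complex.re_ofReal_mul, Complex.add_im, Complex.add_re,
      Complex.im_ofReal_mul, Complex.re_ofReal_mul, show ((algebraMap ℝ ℂ) ‖w‖ ^ 2) = _ from e2,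
      Complex.ofReal_im, Complex.ofReal_re, add_zero, abs_mul, abs_mul, abs_of_pos hn]
    refine mul_le_mul_of_nonneg_left ?_ hn.le
    have := mul_le_mul_of_nonneg_left h1 hn.le
    have := sq_nonneg ‖w‖
    linarith
  · refine Commute.smul_left (Commute.smul_right (Commute.sub_left (Commute.one_left _) ?_) _) _
    refine Commute.sub_right (Commute.one_right _) ?_
    exact ((hcomm m n).smul_left _).smul_right _
  · have hBu : ∀ n u g, (u, g) ∈ G → B n u = ((n + 1 : ℝ) : ℂ) • R n g := fun n u g h => by
      have h1 := hR_mem n u g h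
      rw [_root_.map_add, _root_.map_smul] at h1
      rw [hBf]
      nth_rewrite 1 [← h1]
      rw [add_sub_cancel_right]
    have hconv : ∀ y, Tendsto (fun n : ℕ => ((n + 1 : ℝ) : ℂ) • R n y) atTop (𝓝 y) := fun y => by
      rw [Metric.tendsto_atTop]
      intro ε hε
      obtain ⟨v, hv, k, hk⟩ := Metric.dense_iff.1 hG.dense_domain y (ε / 3) (by positivity)
      rw [Metric.mem_ball, dist_eq_norm] at hv
      obtain ⟨K, hK⟩ := exists_nat_gt (‖k‖ / (ε / 3))
      refine ⟨K, fun n hn => ?_⟩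
      -- `n (n + A)⁻¹ v - v = - (n + A)⁻¹ A v`
      have h1 := hR_mem n v k hk
      rw [_root_.map_add, _root_.map_smul] at h1
      have h2 : ‖R n k‖ < ε / 3 := by
        have h3 := hRn n k
        rw [div_lt_iff₀ (by positivity)] at hK
        have h4 : (K : ℝ) ≤ n := by exact_mod_cast hn
        by_contra hc
        push Not at hc
        nlinarith [mul_le_mul_of_nonneg_left hc (hpos n).le]
      have h5 : ‖((n + 1 : ℝ) : ℂ) • R n (y - v)‖ ≤ ‖v - y‖ := by
        rw [norm_smul, Complex.norm_real, Real.norm_of_nonneg (hpos n).le, norm_sub_rev v]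
        exact hRn n _
      have e : ((n + 1 : ℝ) : ℂ) • R n y - y
          = ((n + 1 : ℝ) : ℂ) • R n (y - v) + (v - y) - R n k := by
        rw [map_sub, smul_sub]
        rw [← eq_sub_iff_add_eq'] at h1
        rw [h1]; abel
      rw [dist_eq_norm, e]
      have := norm_sub_le (((n + 1 : ℝ) : ℂ) • R n (y - v) + (v - y)) (R n k)
      have := norm_add_le (((n + 1 : ℝ) : ℂ) • R n (y - v)) (v - y)
      linarith
    exact (hconv g).congr fun n => (hBu n u g h).symm

/-- The generation theorem: if `G` is the graph of a densely defined m-sectorial operator `A`, then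
`-A` generates an analytic contraction semigroup. -/
theorem exists_semigroup [CompleteSpace H] (hG : IsMSectorialGraph G) :
    ∃ T : ℝ → H →L[ℂ] H, IsAnalyticContractionSemigroup T ∧
      ∀ u w : H, (u, -w) ∈ G ↔
        Tendsto (fun t : ℝ => ((t⁻¹ : ℝ) : ℂ) • (T t u - u)) (𝓝[>] 0) (𝓝 w) := by
  obtain ⟨B, hB, hc, hlim⟩ := hG.exists_yosida
  obtain ⟨S, hS⟩ := exists_limit_expFamily hB hc
    (hG.dense_domain.mono (by rintro u ⟨f, hf⟩; exact ⟨f, hlim u f hf⟩))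
  have hfwd : ∀ u w : H, (u, -w) ∈ G →
      Tendsto (fun t : ℝ => ((t⁻¹ : ℝ) : ℂ) • (S t u - u)) (𝓝[>] 0) (𝓝 w) := fun u w h => by
    simpa using hS.tendsto_slope hB (hlim _ _ h)
  refine ⟨fun t => S t, hS.isAnalyticContractionSemigroup hB, fun u w => ⟨hfwd u w, fun h => ?_⟩⟩
  -- the generator is dissipative and extends `-A`, and `1 + A` is onto, so it equals `-A`
  obtain ⟨v, hv⟩ := hG.exists_resolvent 1 one_pos (u - w)
  have e : u - w - ((1 : ℝ) : ℂ) • v = -(w - (u - v)) := by simp; abel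
  rw [e] at hv
  have hd : Tendsto (fun t : ℝ => ((t⁻¹ : ℝ) : ℂ) • (S t (u - v) - (u - v))) (𝓝[>] 0)
      (𝓝 (u - v)) := by
    have := h.sub (hfwd v _ hv)
    rw [sub_sub_cancel] at this
    refine this.congr fun t => ?_
    rw [map_sub, ← smul_sub]
    congr 1; abel
  have hle : (inner ℂ (u - v) (u - v)).re ≤ 0 := by
    have h1 : Tendsto (fun t : ℝ => (inner ℂ (u - v)
        (((t⁻¹ : ℝ) : ℂ) • (S t (u - v) - (u - v)))).re) (𝓝[>] 0)
        (𝓝 (inner ℂ (u - v) (u - v)).re) :=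
      (Complex.continuous_re.tendsto _).comp (tendsto_const_nhds.inner hd)
    refine le_of_tendsto h1 ?_
    filter_upwards [self_mem_nhdsWithin] with t (ht : 0 < t)
    rw [inner_smul_right, Complex.re_ofReal_mul, inner_sub_right, Complex.sub_re]
    have h2 : (inner ℂ (u - v) (S t (u - v))).re ≤ ‖u - v‖ * ‖S t (u - v)‖ :=
      re_inner_le_norm (𝕜 := ℂ) _ _
    have h3 : (inner ℂ (u - v) (u - v)).re = ‖u - v‖ ^ 2 := inner_self_eq_norm_sq (𝕜 := ℂ) _
    have h4 := mul_le_mul_of_nonneg_left (hS.norm_apply_le hB (ofReal_mem_cone ht.le) (u - v))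
      (norm_nonneg (u - v))
    refine mul_nonpos_of_nonneg_of_nonpos (by positivity) ?_
    nlinarith
  have h0 : u - v = 0 := by
    rw [← norm_eq_zero, ← sq_eq_zero_iff]
    have h3 : (inner ℂ (u - v) (u - v)).re = ‖u - v‖ ^ 2 := inner_self_eq_norm_sq (𝕜 := ℂ) _
    exact le_antisymm (h3 ▸ hle) (sq_nonneg _)
  rw [h0, sub_zero] at hv
  rwa [sub_eq_zero.1 h0]

end IsMSectorialGraph

end Generation

/-! ### Completion for the form norm -/

section FormClosure

universe u₁ u₂

variable {𝒟 : Type u₁} {H : Type u₂} [AddCommGroup 𝒟] [Module ℂ 𝒟] [NormedAddCommGroup H]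
  [InnerProductSpace ℂ H]

/-- The inner product `(⟨j u, L v⟩ + ⟨L u, j v⟩) / 2 + ⟨j u, j v⟩`, which induces the form norm. -/
@[reducible]
noncomputable def formCore (j L : 𝒟 →ₗ[ℂ] H) (hs : ∀ u, inner ℂ (j u) (L u) ∈ cone) :
    PreInnerProductSpace.Core ℂ 𝒟 where
  inner u v := (1 / 2 : ℂ) * (inner ℂ (j u) (L v) + inner ℂ (L u) (j v)) + inner ℂ (j u) (j v)
  conj_inner_symm u v := by
    simp only [map_add, map_mul, inner_conj_symm, map_div₀, map_one, map_ofNat]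
    ring
  re_inner_nonneg u := by
    have h1 : 0 ≤ (inner ℂ (j u) (L u)).re := (abs_nonneg _).trans (hs u)
    have h2 : 0 ≤ (inner ℂ (j u) (j u)).re := inner_self_nonneg (𝕜 := ℂ)
    have h3 : (inner ℂ (L u) (j u)).re = (inner ℂ (j u) (L u)).re := inner_re_symm (𝕜 := ℂ) _ _
    have e : ((1 / 2 : ℂ) * (inner ℂ (j u) (L u) + inner ℂ (L u) (j u)) + inner ℂ (j u) (j u)).re
      = (inner ℂ (j u) (L u)).re + (inner ℂ (j u) (j u)).re := by
      rw [show (1 / 2 : ℂ) = ((1 / 2 : ℝ) : ℂ) by push_cast; ring, Complex.add_re,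
        Complex.re_ofReal_mul, Complex.add_re, h3]
      ring
    rw [RCLike.re_to_complex, e]
    positivity
  add_left u v w := by simp only [map_add, inner_add_left]; ring
  smul_left u v a := by simp only [map_smul, inner_smul_left]; ring

/-- The completion of `𝒟` for the form norm. -/
lemma exists_formCompletion (j L : 𝒟 →ₗ[ℂ] H) (hs : ∀ u, inner ℂ (j u) (L u) ∈ cone) :
    ∃ (V : Type u₁) (_ : NormedAddCommGroup V) (_ : InnerProductSpace ℂ V) (_ : CompleteSpace V)
      (c : 𝒟 →ₗ[ℂ] V), DenseRange c ∧
        ∀ u, ‖c u‖ ^ 2 = (inner ℂ (j u) (L u)).re + ‖j u‖ ^ 2 := by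
  let core := formCore j L hs
  let i1 : SeminormedAddCommGroup 𝒟 :=
    InnerProductSpace.Core.toSeminormedAddCommGroup (𝕜 := ℂ) (c := core)
  let i2 : InnerProductSpace ℂ 𝒟 := InnerProductSpace.ofCore core
  refine ⟨UniformSpace.Completion 𝒟, inferInstance, inferInstance, inferInstance,
    (UniformSpace.Completion.toComplL (𝕜 := ℂ) (E := 𝒟)).toLinearMap,
    UniformSpace.Completion.denseRange_coe, fun u => ?_⟩
  have h1 : ‖(u : UniformSpace.Completion 𝒟)‖ ^ 2 = (core.inner u u).re := by
    rw [UniformSpace.Completion.norm_coe]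
    exact norm_sq_eq_re_inner (𝕜 := ℂ) u
  refine h1.trans ?_
  have h3 : (inner ℂ (L u) (j u)).re = (inner ℂ (j u) (L u)).re := inner_re_symm (𝕜 := ℂ) _ _
  have h4 : (inner ℂ (j u) (j u)).re = ‖j u‖ ^ 2 := inner_self_eq_norm_sq (𝕜 := ℂ) _
  change ((1 / 2 : ℂ) * (inner ℂ (j u) (L u) + inner ℂ (L u) (j u)) + inner ℂ (j u) (j u)).re = _
  rw [show (1 / 2 : ℂ) = ((1 / 2 : ℝ) : ℂ) by push_cast; ring, Complex.add_re,
        Complex.re_ofReal_mul, Complex.add_re, h3, h4]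
  ring

end FormClosure

/-! ### The closure of a sectorial form and its operator -/

/-- The Lax–Milgram lemma: a bounded coercive operator on a Hilbert space is onto. -/
lemma surjective_of_coercive {V : Type*} [NormedAddCommGroup V] [InnerProductSpace ℂ V]
    [CompleteSpace V] (C : V →L[ℂ] V) {c : ℝ} (hc : 0 < c)
    (hC : ∀ x, c * ‖x‖ ^ 2 ≤ (inner ℂ x (C x)).re) : Function.Surjective C := by
  have hb : ∀ x, c * ‖x‖ ≤ ‖C x‖ := fun x => by
    have h1 := hC x
    have h2 : (inner ℂ x (C x)).re ≤ ‖x‖ * ‖C x‖ := re_inner_le_norm (𝕜 := ℂ) _ _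
    rcases (norm_nonneg x).eq_or_lt with h0 | h0
    · rw [← h0]; simp
    · refine le_of_mul_le_mul_left ?_ h0
      nlinarith
  have ha : AntilipschitzWith (Real.toNNReal c⁻¹) C := by
    refine AddMonoidHomClass.antilipschitz_of_bound C fun x => ?_
    rw [Real.coe_toNNReal _ (by positivity), le_inv_mul_iff₀ hc]
    exact hb x
  have hcl : IsClosed (LinearMap.range (C : V →ₗ[ℂ] V) : Set V) := by
    simpa using! ha.isClosed_range C.uniformContinuous
  have : CompleteSpace (LinearMap.range (C : V →ₗ[ℂ] V)) := hcl.completeSpace_coe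
  have hbot : (LinearMap.range (C : V →ₗ[ℂ] V))ᗮ = ⊥ := by
    rw [Submodule.eq_bot_iff]
    intro y hy
    rw [Submodule.mem_orthogonal'] at hy
    have h0 := hy (C y) ⟨y, rfl⟩
    have h1 := hC y
    rw [h0, Complex.zero_re] at h1
    have h2 : ‖y‖ ^ 2 ≤ 0 := by
      by_contra h; push Not at h; nlinarith
    exact norm_eq_zero.1 (sq_eq_zero_iff.1 (le_antisymm h2 (sq_nonneg _)))
  rw [Submodule.orthogonal_eq_bot_iff] at hbot
  exact fun y => by
    have : y ∈ LinearMap.range (C : V →ₗ[ℂ] V) := hbot ▸ Submodule.mem_top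
    exact this

lemma isClosed_cone : IsClosed cone :=
  isClosed_le (by fun_prop) (by fun_prop)

lemma norm_le_of_mem_cone {z : ℂ} (hz : z ∈ cone) : ‖z‖ ≤ 2 * z.re := by
  have := Complex.norm_le_abs_re_add_abs_im z
  have h : |z.im| ≤ z.re := hz
  rw [abs_of_nonneg ((abs_nonneg _).trans h)] at this
  linarith

section FormClosure

universe u₁ u₂

variable {𝒟 : Type u₁} {H : Type u₂} [AddCommGroup 𝒟] [Module ℂ 𝒟] [NormedAddCommGroup H]
  [InnerProductSpace ℂ H]

/-- A sectorial form is bounded for the seminorm given by its real part. -/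
lemma norm_form_le {V : Type*} [NormedAddCommGroup V] [NormedSpace ℂ V] {j L : 𝒟 →ₗ[ℂ] H}
    {c : 𝒟 →ₗ[ℂ] V} (hs : ∀ u, inner ℂ (j u) (L u) ∈ cone)
    (hc : ∀ u, ‖c u‖ ^ 2 = (inner ℂ (j u) (L u)).re + ‖j u‖ ^ 2) (u v : 𝒟) :
    ‖inner ℂ (j v) (L u)‖ ≤ 4 * ‖c u‖ * ‖c v‖ := by
  have hn : ∀ w, ‖inner ℂ (j w) (L w)‖ ≤ 2 * (inner ℂ (j w) (L w)).re := fun w =>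
    norm_le_of_mem_cone (hs w)
  have hcr : ∀ w, (inner ℂ (j w) (L w)).re ≤ ‖c w‖ ^ 2 := fun w => by
    rw [hc w]; linarith [sq_nonneg ‖j w‖]
  -- polarization
  have hpol : ∀ u v, ‖inner ℂ (j v) (L u)‖ ≤ 2 * (‖c u‖ ^ 2 + ‖c v‖ ^ 2) := fun u v => by
    have e : 4 * inner ℂ (j v) (L u)
        = inner ℂ (j (u + v)) (L (u + v)) - inner ℂ (j (u - v)) (L (u - v))
          + Complex.I * inner ℂ (j (u + Complex.I • v)) (L (u + Complex.I • v))
          - Complex.I * inner ℂ (j (u - Complex.I • v)) (L (u - Complex.I • v)) := by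
      simp only [map_add, map_sub, map_smul, inner_add_left, inner_add_right, inner_sub_left,
        inner_sub_right, inner_smul_left, inner_smul_right, Complex.conj_I]
      linear_combination (2 * (inner ℂ (j v) (L u) - inner ℂ (j u) (L v))) * Complex.I_mul_I
    have hsum : (inner ℂ (j (u + v)) (L (u + v))).re + (inner ℂ (j (u - v)) (L (u - v))).re
          + (inner ℂ (j (u + Complex.I • v)) (L (u + Complex.I • v))).re
          + (inner ℂ (j (u - Complex.I • v)) (L (u - Complex.I • v))).re
        = 4 * (inner ℂ (j u) (L u)).re + 4 * (inner ℂ (j v) (L v)).re := by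
      simp only [← Complex.add_re]
      rw [← Complex.re_ofReal_mul 4, ← Complex.re_ofReal_mul 4, ← Complex.add_re]
      congr 1
      simp only [map_add, map_sub, map_smul, inner_add_left, inner_add_right, inner_sub_left,
        inner_sub_right, inner_smul_left, inner_smul_right, Complex.conj_I]
      push_cast
      linear_combination (-2 * inner ℂ (j v) (L v)) * Complex.I_mul_I
    have h4 : ‖4 * inner ℂ (j v) (L u)‖ = 4 * ‖inner ℂ (j v) (L u)‖ := by simp
    have hI : ∀ z : ℂ, ‖Complex.I * z‖ = ‖z‖ := fun z => by simp
    have t1 := norm_sub_le (inner ℂ (j (u + v)) (L (u + v)) - inner ℂ (j (u - v)) (L (u - v))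
          + Complex.I * inner ℂ (j (u + Complex.I • v)) (L (u + Complex.I • v)))
          (Complex.I * inner ℂ (j (u - Complex.I • v)) (L (u - Complex.I • v)))
    have t2 := norm_add_le (inner ℂ (j (u + v)) (L (u + v)) - inner ℂ (j (u - v)) (L (u - v)))
          (Complex.I * inner ℂ (j (u + Complex.I • v)) (L (u + Complex.I • v)))
    have t3 := norm_sub_le (inner ℂ (j (u + v)) (L (u + v))) (inner ℂ (j (u - v)) (L (u - v)))
    rw [← e, h4] at t1
    rw [hI] at t1 t2
    have := hn (u + v); have := hn (u - v)
    have := hn (u + Complex.I • v); have := hn (u - Complex.I • v)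
    have := hcr u; have := hcr v
    linarith
  -- scaling
  have hscale : ∀ δ : ℝ, 0 < δ →
      ‖inner ℂ (j v) (L u)‖ ≤ 4 * (‖c u‖ + δ) * (‖c v‖ + δ) := fun δ hδ => by
    have ha : 0 < ‖c u‖ + δ := by positivity
    have hb : 0 < ‖c v‖ + δ := by positivity
    set a := ‖c u‖ + δ
    set b := ‖c v‖ + δ
    have h := hpol (((a⁻¹ : ℝ) : ℂ) • u) (((b⁻¹ : ℝ) : ℂ) • v)
    simp only [map_smul, norm_smul, inner_smul_left, inner_smul_right, norm_mul, Complex.conj_ofReal,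
      Complex.norm_real, norm_inv, Real.norm_of_nonneg ha.le, Real.norm_of_nonneg hb.le] at h
    have h1 : a⁻¹ * ‖c u‖ ≤ 1 := by rw [inv_mul_le_iff₀ ha]; simp only [a]; linarith
    have h2 : b⁻¹ * ‖c v‖ ≤ 1 := by rw [inv_mul_le_iff₀ hb]; simp only [b]; linarith
    have h3 : (a⁻¹ * ‖c u‖) ^ 2 ≤ 1 := pow_le_one₀ (by positivity) h1
    have h4 : (b⁻¹ * ‖c v‖) ^ 2 ≤ 1 := pow_le_one₀ (by positivity) h2
    have h5 : b⁻¹ * (a⁻¹ * ‖inner ℂ (j v) (L u)‖) ≤ 4 := by linarith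
    rw [inv_mul_le_iff₀ hb, inv_mul_le_iff₀ ha] at h5
    linarith
  have hlim : Tendsto (fun δ : ℝ => 4 * (‖c u‖ + δ) * (‖c v‖ + δ)) (𝓝[>] 0)
      (𝓝 (4 * ‖c u‖ * ‖c v‖)) := by
    refine Tendsto.mono_left (Continuous.tendsto' (by fun_prop) _ _ (by simp)) nhdsWithin_le_nhds
  exact ge_of_tendsto hlim (by filter_upwards [self_mem_nhdsWithin] with δ hδ using hscale δ hδ)

/-- Data realizing the closure of the form `⟨j v, L u⟩` on `𝒟`: a Hilbert space `V` that completes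
`𝒟` for the form norm, the extension `ι : V → H` of `j`, and the bounded operator `T` on `V` such
that `⟨y, T x⟩` is the extension of the form. -/
structure IsFormClosure {V : Type*} [NormedAddCommGroup V] [InnerProductSpace ℂ V]
    (j L : 𝒟 →ₗ[ℂ] H) (c : 𝒟 →ₗ[ℂ] V) (ι : V →L[ℂ] H) (T : V →L[ℂ] V) : Prop where
  dense_j : DenseRange j
  mem_cone : ∀ u, inner ℂ (j u) (L u) ∈ cone
  dense_c : DenseRange c
  norm_sq : ∀ u, ‖c u‖ ^ 2 = (inner ℂ (j u) (L u)).re + ‖j u‖ ^ 2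
  map_c : ∀ u, ι (c u) = j u
  inner_c : ∀ u v, inner ℂ (c v) (T (c u)) = inner ℂ (j v) (L u)

lemma exists_isFormClosure [CompleteSpace H] {j L : 𝒟 →ₗ[ℂ] H} (hj : DenseRange j)
    (hs : ∀ u, inner ℂ (j u) (L u) ∈ cone) :
    ∃ (V : Type u₁) (_ : NormedAddCommGroup V) (_ : InnerProductSpace ℂ V) (_ : CompleteSpace V)
      (c : 𝒟 →ₗ[ℂ] V) (ι : V →L[ℂ] H) (T : V →L[ℂ] V), IsFormClosure j L c ι T := by
  obtain ⟨V, i1, i2, i3, c, hd, hc⟩ := exists_formCompletion j L hs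
  have hjc : ∀ u, ‖j u‖ ≤ 1 * ‖c u‖ := fun u => by
    rw [one_mul]
    refine (pow_le_pow_iff_left₀ (norm_nonneg _) (norm_nonneg _) two_ne_zero).1 ?_
    rw [hc]
    have : 0 ≤ (inner ℂ (j u) (L u)).re := (abs_nonneg _).trans (hs u)
    linarith
  let φ : 𝒟 → 𝒟 →ₗ[ℂ] ℂ := fun u => (innerSL ℂ (L u)).toLinearMap.comp j
  have hφ : ∀ u v, ‖φ u v‖ ≤ (4 * ‖c u‖) * ‖c v‖ := fun u v => by
    have h := norm_form_le hs hc u v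
    rw [norm_inner_symm] at h
    exact h
  let t : 𝒟 → V := fun u => (InnerProductSpace.toDual ℂ V).symm ((φ u).extendOfNorm c)
  have ht : ∀ u v, inner ℂ (t u) (c v) = inner ℂ (L u) (j v) := fun u v => by
    simp only [t, InnerProductSpace.toDual_symm_apply]
    rw [LinearMap.extendOfNorm_eq hd ⟨_, hφ u⟩]
    rfl
  let tl : 𝒟 →ₗ[ℂ] V :=
    { toFun := t
      map_add' := fun u v => hd.eq_of_inner_left ℂ fun w => by
        simp only [inner_add_left, ht, map_add]
      map_smul' := fun a u => hd.eq_of_inner_left ℂ fun w => by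
        simp only [inner_smul_left, ht, map_smul, RingHom.id_apply] }
  have htl : ∀ u, ‖tl u‖ ≤ 4 * ‖c u‖ := fun u => by
    change ‖t u‖ ≤ _
    simp only [t, LinearIsometryEquiv.norm_map]
    exact LinearMap.opNorm_extendOfNorm_le hd (by positivity) (hφ u)
  refine ⟨V, i1, i2, i3, c, j.extendOfNorm c, tl.extendOfNorm c, hj, hs, hd, hc,
    LinearMap.extendOfNorm_eq hd ⟨1, hjc⟩, fun u v => ?_⟩
  rw [LinearMap.extendOfNorm_eq hd ⟨4, htl⟩, ← inner_conj_symm]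
  change (starRingEnd ℂ) (inner ℂ (t u) (c v)) = _
  rw [ht, inner_conj_symm]

namespace IsFormClosure

variable {V : Type*} [NormedAddCommGroup V] [InnerProductSpace ℂ V]
  {j L : 𝒟 →ₗ[ℂ] H} {c : 𝒟 →ₗ[ℂ] V} {ι : V →L[ℂ] H} {T : V →L[ℂ] V} {q : 𝒟 → 𝒟 → ℂ}

lemma inner_map_c (h : IsFormClosure j L c ι T) (u : 𝒟) (y : V) :
    inner ℂ y (T (c u)) = inner ℂ (ι y) (L u) := by
  refine h.dense_c.induction_on y (isClosed_eq (by fun_prop) (by fun_prop)) fun v => ?_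
  rw [h.inner_c, h.map_c]

lemma inner_mem_cone (h : IsFormClosure j L c ι T) (x : V) : inner ℂ x (T x) ∈ cone := by
  refine h.dense_c.induction_on x (isClosed_cone.preimage (by fun_prop)) fun v => ?_
  rw [h.inner_c]
  exact h.mem_cone v

lemma norm_sq_eq (h : IsFormClosure j L c ι T) (x : V) :
    ‖x‖ ^ 2 = (inner ℂ x (T x)).re + ‖ι x‖ ^ 2 := by
  refine h.dense_c.induction_on x (isClosed_eq (by fun_prop) ?_) fun v => ?_
  · exact (Complex.continuous_re.comp (by fun_prop)).add (by fun_prop)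
  · rw [h.inner_c, h.map_c, h.norm_sq]

/-- The form is closable: the extension of `j` to the completion is injective. -/
lemma injective (h : IsFormClosure j L c ι T) : Function.Injective ι := by
  rw [injective_iff_map_eq_zero]
  intro x hx
  -- `⟨x, T y⟩` vanishes for `y` in the dense range of `c`, hence for `y = x`
  have h1 : ∀ y, inner ℂ x (T y) = 0 := fun y =>
    h.dense_c.induction_on y (isClosed_eq (by fun_prop) (by fun_prop)) fun v => by
      rw [h.inner_map_c, hx, inner_zero_left]
  have h2 := h.norm_sq_eq x
  rw [h1, hx] at h2
  simpa using h2

lemma formNorm_eq (h : IsFormClosure j L c ι T) (hq : ∀ u v, q u v = inner ℂ (j v) (L u))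
    (u : 𝒟) : formNorm j q u = ‖c u‖ := by
  rw [formNorm, hq, ← h.norm_sq, Real.sqrt_sq (norm_nonneg _)]

lemma continuousForm (h : IsFormClosure j L c ι T) (hq : ∀ u v, q u v = inner ℂ (j v) (L u)) :
    ContinuousForm j q :=
  ⟨4, fun u v => by
    rw [h.formNorm_eq hq, h.formNorm_eq hq, hq]
    exact norm_form_le h.mem_cone h.norm_sq u v⟩

lemma approximates_iff [CompleteSpace V] (h : IsFormClosure j L c ι T)
    (hq : ∀ u v, q u v = inner ℂ (j v) (L u)) {φ : ℕ → 𝒟} {u : H} :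
    Approximates j q φ u ↔ ∃ x, ι x = u ∧ Tendsto (fun n => c (φ n)) atTop (𝓝 x) := by
  have hcau : FormCauchy j q φ ↔ CauchySeq fun n => c (φ n) := by
    rw [Metric.cauchySeq_iff]
    simp only [FormCauchy, h.formNorm_eq hq, map_sub, dist_eq_norm, gt_iff_lt]
  have hj : ∀ {x}, Tendsto (fun n => c (φ n)) atTop (𝓝 x) →
      Tendsto (fun n => j (φ n)) atTop (𝓝 (ι x)) := fun hx => by
    simpa only [Function.comp_def, h.map_c] using (ι.continuous.tendsto _).comp hx
  constructor
  · rintro ⟨h1, h2⟩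
    obtain ⟨x, hx⟩ := cauchySeq_tendsto_of_complete (hcau.1 h1)
    exact ⟨x, tendsto_nhds_unique (hj hx) h2, hx⟩
  · rintro ⟨x, rfl, hx⟩
    exact ⟨hcau.2 hx.cauchySeq, hj hx⟩

lemma exists_approximates [CompleteSpace V] (h : IsFormClosure j L c ι T)
    (hq : ∀ u v, q u v = inner ℂ (j v) (L u)) (x : V) : ∃ φ, Approximates j q φ (ι x) := by
  obtain ⟨y, hy, hx⟩ := mem_closure_iff_seq_limit.1 (h.dense_c x)
  choose φ hφ using hy
  exact ⟨φ, (h.approximates_iff hq).2 ⟨x, rfl, by simpa only [hφ] using hx⟩⟩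

lemma mem_closureDomain_iff [CompleteSpace V] (h : IsFormClosure j L c ι T)
    (hq : ∀ u v, q u v = inner ℂ (j v) (L u)) {u : H} :
    u ∈ closureDomain j q ↔ ∃ x, ι x = u := by
  constructor
  · rintro ⟨φ, hφ⟩
    obtain ⟨x, hx, -⟩ := (h.approximates_iff hq).1 hφ
    exact ⟨x, hx⟩
  · rintro ⟨x, rfl⟩
    exact h.exists_approximates hq x

lemma closureValue_iff [CompleteSpace V] (h : IsFormClosure j L c ι T)
    (hq : ∀ u v, q u v = inner ℂ (j v) (L u)) {x y : V} {z : ℂ} :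
    ClosureValue j q (ι x) (ι y) z ↔ inner ℂ y (T x) = z := by
  have key : ∀ φ ψ, Approximates j q φ (ι x) → Approximates j q ψ (ι y) →
      Tendsto (fun n => q (φ n) (ψ n)) atTop (𝓝 (inner ℂ y (T x))) := fun φ ψ hφ hψ => by
    obtain ⟨x', hx', hφ⟩ := (h.approximates_iff hq).1 hφ
    obtain ⟨y', hy', hψ⟩ := (h.approximates_iff hq).1 hψ
    rw [h.injective hx'] at hφ
    rw [h.injective hy'] at hψ
    simp only [hq, ← h.inner_c]
    exact hψ.inner ((T.continuous.tendsto _).comp hφ)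
  constructor
  · intro hz
    obtain ⟨φ, hφ⟩ := h.exists_approximates hq x
    obtain ⟨ψ, hψ⟩ := h.exists_approximates hq y
    exact tendsto_nhds_unique (key φ ψ hφ hψ) (hz φ ψ hφ hψ)
  · rintro rfl
    exact key

lemma closable [CompleteSpace V] (h : IsFormClosure j L c ι T)
    (hq : ∀ u v, q u v = inner ℂ (j v) (L u)) : Closable j q := by
  intro φ hφ
  have h0 : ClosureValue j q (ι 0) (ι 0) 0 := (h.closureValue_iff hq).2 (by simp)
  rw [map_zero] at h0
  exact h0 φ φ hφ hφ

/-- The graph of the operator associated with the closure of the form. -/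
def graph (_ : IsFormClosure j L c ι T) : Submodule ℂ (H × H) where
  carrier := {p | ∃ x, ι x = p.1 ∧ ∀ y, inner ℂ y (T x) = inner ℂ (ι y) p.2}
  zero_mem' := ⟨0, by simp, by simp⟩
  add_mem' := by
    rintro p p' ⟨x, hx, h1⟩ ⟨x', hx', h2⟩
    exact ⟨x + x', by simp [hx, hx'], fun y => by simp [h1, h2]⟩
  smul_mem' := by
    rintro a p ⟨x, hx, h1⟩
    exact ⟨a • x, by simp [hx], fun y => by simp [h1]⟩

lemma mem_graph_iff_associatedGraph [CompleteSpace V] (h : IsFormClosure j L c ι T)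
    (hq : ∀ u v, q u v = inner ℂ (j v) (L u)) {u f : H} :
    (u, f) ∈ h.graph ↔ AssociatedGraph j q u f := by
  constructor
  · rintro ⟨x, rfl, hx⟩
    refine ⟨(h.mem_closureDomain_iff hq).2 ⟨x, rfl⟩, fun v hv => ?_⟩
    obtain ⟨y, rfl⟩ := (h.mem_closureDomain_iff hq).1 hv
    exact (h.closureValue_iff hq).2 (hx y)
  · rintro ⟨hu, hf⟩
    obtain ⟨x, rfl⟩ := (h.mem_closureDomain_iff hq).1 hu
    exact ⟨x, rfl, fun y =>
      (h.closureValue_iff hq).1 (hf _ ((h.mem_closureDomain_iff hq).2 ⟨y, rfl⟩))⟩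

lemma mem_graph_map (h : IsFormClosure j L c ι T) (u : 𝒟) : (j u, L u) ∈ h.graph :=
  ⟨c u, h.map_c u, fun y => h.inner_map_c u y⟩

lemma eq_zero_of_mem_graph (h : IsFormClosure j L c ι T) {f : H} (hf : (0, f) ∈ h.graph) :
    f = 0 := by
  obtain ⟨x, hx, hf⟩ := hf
  have hx0 : x = 0 := h.injective (by simpa using hx)
  refine h.dense_j.eq_of_inner_right ℂ fun v => ?_
  rw [← h.map_c, ← hf, hx0]
  simp

lemma isMSectorialGraph [CompleteSpace V] [CompleteSpace H] (h : IsFormClosure j L c ι T) :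
    IsMSectorialGraph h.graph where
  inner_mem := by
    rintro u f ⟨x, rfl, hx⟩
    rw [← hx]
    exact h.inner_mem_cone x
  exists_resolvent μ hμ f := by
    -- solve `q(x, y) + μ ⟨ι y, ι x⟩ = ⟨ι y, f⟩` by the Lax–Milgram lemma
    let ι' := ContinuousLinearMap.adjoint ι
    have hs := surjective_of_coercive (T + (μ : ℂ) • (ι' ∘L ι)) (c := min 1 μ)
      (lt_min one_pos hμ) fun x => by
        have h1 := h.norm_sq_eq x
        have h2 : (inner ℂ (ι x) (ι x)).re = ‖ι x‖ ^ 2 := inner_self_eq_norm_sq (𝕜 := ℂ) _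
        have h3 : 0 ≤ (inner ℂ x (T x)).re := (abs_nonneg _).trans (h.inner_mem_cone x)
        rw [add_apply, smul_apply, ContinuousLinearMap.comp_apply, inner_add_right,
          inner_smul_right, ContinuousLinearMap.adjoint_inner_right, Complex.add_re,
          Complex.re_ofReal_mul, h2, h1]
        have h4 := min_le_left 1 μ
        have h5 := min_le_right 1 μ
        have h6 := mul_le_mul_of_nonneg_right h4 h3
        have h7 := mul_le_mul_of_nonneg_right h5 (sq_nonneg ‖ι x‖)
        linarith
    obtain ⟨x, hx⟩ := hs (ι' f)
    refine ⟨ι x, x, rfl, fun y => ?_⟩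
    have h1 : inner ℂ y ((T + (μ : ℂ) • (ι' ∘L ι)) x) = inner ℂ (ι y) f := by
      rw [hx, ContinuousLinearMap.adjoint_inner_right]
    rw [add_apply, smul_apply, ContinuousLinearMap.comp_apply, inner_add_right,
          inner_smul_right, ContinuousLinearMap.adjoint_inner_right] at h1
    change _ = inner ℂ (ι y) (f - (μ : ℂ) • ι x)
    rw [inner_sub_right, inner_smul_right, ← h1]
    ring
  dense_domain := h.dense_j.mono (by rintro _ ⟨u, rfl⟩; exact ⟨L u, h.mem_graph_map u⟩)

end IsFormClosure

end FormClosure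

/-! ### Shifts of forms, operators and semigroups -/

section Shift

variable {H : Type*} [NormedAddCommGroup H] [InnerProductSpace ℂ H]

lemma IsC0Semigroup.exp_smul {T : ℝ → H →L[ℂ] H} (hT : IsC0Semigroup T) (a : ℝ) :
    IsC0Semigroup fun t => (Real.exp (a * t) : ℂ) • T t where
  map_zero := by simp [hT.map_zero]
  map_add s t hs ht := by
    rw [hT.map_add s t hs ht, mul_add, Real.exp_add, Complex.ofReal_mul, smul_mul_smul_comm]
  continuousOn x := by
    refine ContinuousOn.smul (f := fun t : ℝ => (Real.exp (a * t) : ℂ)) ?_ (hT.continuousOn x)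
    fun_prop

lemma IsAnalyticExtension.exp_smul {T : ℝ → H →L[ℂ] H} {θ : ℝ} {S : ℂ → H →L[ℂ] H}
    (hS : IsAnalyticExtension T θ S) (a : ℝ) :
    IsAnalyticExtension (fun t => (Real.exp (a * t) : ℂ) • T t) θ
      (fun z => Complex.exp (a * z) • S z) where
  angle_pos := hS.angle_pos
  angle_le := hS.angle_le
  extends_real t ht := by
    simp only [hS.extends_real t ht, Complex.ofReal_exp, Complex.ofReal_mul]
  map_add z hz w hw := by
    rw [hS.map_add z hz w hw, mul_add, Complex.exp_add, smul_mul_smul_comm]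
  differentiableOn := by
    refine DifferentiableOn.smul (c := fun z : ℂ => Complex.exp (a * z)) ?_ hS.differentiableOn
    fun_prop
  tendsto_zero θ' h0 h1 x := by
    have h : Tendsto (fun z : ℂ => Complex.exp (a * z)) (𝓝[sector θ'] 0) (𝓝 1) :=
      (Continuous.tendsto' (by fun_prop) _ _ (by simp)).mono_left nhdsWithin_le_nhds
    simpa using! h.smul (hS.tendsto_zero θ' h0 h1 x)

lemma IsAnalyticContractionSemigroup.exp_smul {T : ℝ → H →L[ℂ] H}
    (hT : IsAnalyticContractionSemigroup T) {a : ℝ} (ha : a ≤ 0) :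
    IsAnalyticContractionSemigroup fun t => (Real.exp (a * t) : ℂ) • T t := by
  obtain ⟨h1, h2, θ, S, h3, h4⟩ := hT
  refine ⟨h1.exp_smul a, fun t ht => ?_, θ, _, h3.exp_smul a, fun z hz => ?_⟩
  · rw [norm_smul, Complex.norm_real, Real.norm_of_nonneg (Real.exp_pos _).le]
    exact mul_le_one₀ (Real.exp_le_one_iff.2 (mul_nonpos_of_nonpos_of_nonneg ha ht))
      (norm_nonneg _) (h2 t ht)
  · rw [norm_smul, Complex.norm_exp]
    refine mul_le_one₀ (Real.exp_le_one_iff.2 ?_) (norm_nonneg _) (h4 z hz)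
    rw [Complex.re_ofReal_mul]
    refine mul_nonpos_of_nonpos_of_nonneg ha ?_
    rw [← Complex.norm_mul_cos_arg]
    have h5 := hz.2
    have h6 := h3.angle_le
    rw [abs_lt] at h5
    exact mul_nonneg (norm_nonneg _)
      (Real.cos_nonneg_of_mem_Icc ⟨by linarith, by linarith⟩)

/-- Rescaling a semigroup by `exp (a t)` adds `a` to its generator, without changing the domain. -/
lemma tendsto_slope_exp_smul_iff {T : ℝ → H →L[ℂ] H} (hT : IsC0Semigroup T) (a : ℝ) (u w : H) :
    Tendsto (fun t : ℝ => ((t⁻¹ : ℝ) : ℂ) • (((Real.exp (a * t) : ℂ) • T t) u - u)) (𝓝[>] 0) (𝓝 w)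
      ↔ Tendsto (fun t : ℝ => ((t⁻¹ : ℝ) : ℂ) • (T t u - u)) (𝓝[>] 0) (𝓝 (w - (a : ℂ) • u)) := by
  have key : ∀ (T : ℝ → H →L[ℂ] H), IsC0Semigroup T → ∀ (a : ℝ) (w : H),
      Tendsto (fun t : ℝ => ((t⁻¹ : ℝ) : ℂ) • (T t u - u)) (𝓝[>] 0) (𝓝 w) →
      Tendsto (fun t : ℝ => ((t⁻¹ : ℝ) : ℂ) • (((Real.exp (a * t) : ℂ) • T t) u - u)) (𝓝[>] 0)
        (𝓝 (w + (a : ℂ) • u)) := by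
    intro T hT a w hw
    have h1 : HasDerivAt (fun t : ℝ => Real.exp (a * t)) a 0 := by
      simpa using ((hasDerivAt_id (0 : ℝ)).const_mul a).exp
    have h2 : Tendsto (fun t : ℝ => t⁻¹ * (Real.exp (a * t) - 1)) (𝓝[>] 0) (𝓝 a) := by
      have := (hasDerivAt_iff_tendsto_slope_zero.1 h1).mono_left
        (nhdsWithin_mono 0 (s := Set.Ioi 0) (fun t ht => ne_of_gt (Set.mem_Ioi.1 ht)))
      simpa using this
    have h3 : Tendsto (fun t => T t u) (𝓝[>] 0) (𝓝 u) := by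
      have := hT.continuousOn u 0 Set.self_mem_Ici
      simp only [ContinuousWithinAt, hT.map_zero] at this
      exact this.mono_left (nhdsWithin_mono _ Set.Ioi_subset_Ici_self)
    have h4 := hw.add (((Complex.continuous_ofReal.tendsto _).comp h2).smul h3)
    refine h4.congr fun t => ?_
    simp only [Function.comp_apply, smul_apply]
    push_cast
    module
  constructor
  · intro h
    have := key _ (hT.exp_smul a) (-a) w h
    convert this using 2
    · congr 2
      rw [smul_smul, ← Complex.ofReal_mul, ← Real.exp_add]
      simp
    · push_cast; module
  · intro h
    simpa using key T hT a _ h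

/-- The graph of `A - a`, where `G` is the graph of `A`. -/
def shiftGraph (G : Submodule ℂ (H × H)) (a : ℂ) : Submodule ℂ (H × H) :=
  G.comap ((LinearMap.fst ℂ H H).prod (LinearMap.snd ℂ H H + a • LinearMap.fst ℂ H H))

lemma mem_shiftGraph {G : Submodule ℂ (H × H)} {a : ℂ} {u f : H} :
    (u, f) ∈ shiftGraph G a ↔ (u, f + a • u) ∈ G := Iff.rfl

lemma mem_graph_neg {A : H →ₗ.[ℂ] H} {u w : H} : (u, w) ∈ (-A).graph ↔ (u, -w) ∈ A.graph := by
  rw [LinearPMap.neg_graph]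
  constructor
  · rintro ⟨⟨a, b⟩, h, he⟩
    simp only [LinearMap.prodMap_apply, LinearMap.id_apply, LinearMap.neg_apply,
      Prod.mk.injEq] at he
    rw [← he.1, ← he.2, neg_neg]
    exact h
  · intro h
    exact ⟨(u, -w), h, by simp⟩

end Shift

section ShiftForm

variable {𝒟 H : Type*} [AddCommGroup 𝒟] [Module ℂ 𝒟] [NormedAddCommGroup H]
  [InnerProductSpace ℂ H]

lemma approximates_shift_iff {j : 𝒟 →ₗ[ℂ] H} {q q' : 𝒟 → 𝒟 → ℂ} {μ : ℝ} (hμ : 0 ≤ μ)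
    (hq : ∀ u v, q' u v = q u v + μ * inner ℂ (j v) (j u)) (ha : Accretive q)
    {φ : ℕ → 𝒟} {u : H} : Approximates j q' φ u ↔ Approximates j q φ u := by
  have hre : ∀ u, (q' u u).re = (q u u).re + μ * ‖j u‖ ^ 2 := fun u => by
    rw [hq, Complex.add_re, Complex.re_ofReal_mul]
    have : (inner ℂ (j u) (j u)).re = ‖j u‖ ^ 2 := inner_self_eq_norm_sq (𝕜 := ℂ) _
    rw [this]
  have h1 : ∀ u, formNorm j q u ≤ formNorm j q' u := fun u => by
    refine Real.sqrt_le_sqrt ?_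
    rw [hre]
    have : 0 ≤ μ * ‖j u‖ ^ 2 := by positivity
    linarith
  have h2 : ∀ u, formNorm j q' u ≤ Real.sqrt (1 + μ) * formNorm j q u := fun u => by
    rw [formNorm, formNorm, ← Real.sqrt_mul (by positivity)]
    refine Real.sqrt_le_sqrt ?_
    rw [hre]
    have h3 : 0 ≤ μ * (q u u).re := mul_nonneg hμ (ha u)
    linarith
  refine and_congr_left fun _ => ⟨fun h ε hε => ?_, fun h ε hε => ?_⟩
  · obtain ⟨K, hK⟩ := h ε hε
    exact ⟨K, fun m hm n hn => (h1 _).trans_lt (hK m hm n hn)⟩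
  · have hs : 0 < Real.sqrt (1 + μ) := Real.sqrt_pos.2 (by positivity)
    obtain ⟨K, hK⟩ := h (ε / Real.sqrt (1 + μ)) (by positivity)
    refine ⟨K, fun m hm n hn => (h2 _).trans_lt ?_⟩
    have := hK m hm n hn
    rwa [lt_div_iff₀' hs] at this

/-- Adding `μ ⟨u, v⟩` to the form adds `μ` to the associated operator: the two form norms are
equivalent, so the closures have the same domain. -/
lemma associatedGraph_shift {j : 𝒟 →ₗ[ℂ] H} {q q' : 𝒟 → 𝒟 → ℂ} {μ : ℝ} (hμ : 0 ≤ μ)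
    (hq : ∀ u v, q' u v = q u v + μ * inner ℂ (j v) (j u)) (ha : Accretive q) {u f : H} :
    AssociatedGraph j q' u (f + (μ : ℂ) • u) ↔ AssociatedGraph j q u f := by
  have happ : ∀ φ u, Approximates j q' φ u ↔ Approximates j q φ u := fun φ u =>
    approximates_shift_iff hμ hq ha
  have hlim : ∀ φ ψ v, Approximates j q φ u → Approximates j q ψ v →
      Tendsto (fun n => (μ : ℂ) * inner ℂ (j (ψ n)) (j (φ n))) atTop (𝓝 (μ * inner ℂ v u)) :=
    fun φ ψ v hφ hψ => (hψ.2.inner hφ.2).const_mul _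
  unfold AssociatedGraph closureDomain ClosureValue
  simp only [happ]
  refine and_congr_right fun _ => forall₂_congr fun v _ => ?_
  refine forall₂_congr fun φ ψ => forall₂_congr fun hφ hψ => ?_
  rw [inner_add_right, inner_smul_right]
  simp only [hq]
  refine ⟨fun h => ?_, fun h => h.add (hlim φ ψ v hφ hψ)⟩
  simpa using h.sub (hlim φ ψ v hφ hψ)

lemma ofReal_add_mem_cone {z : ℂ} (hz : z ∈ cone) {r : ℝ} (hr : 0 ≤ r) : z + r ∈ cone :=
  add_mem_cone hz (ofReal_mem_cone hr)

/-- The generation theorem for a family of forms `q lam u v = ⟨j v, L u + lam j u⟩`: if the form is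
sectorial for `lam = lam₀`, then for all `lam ≥ lam₀` it is closable and associated with an operator
`A + lam`, where `A` extends `j u ↦ L u`, and `-A` generates an analytic semigroup. -/
theorem exists_operator_and_semigroup [CompleteSpace H] {j L : 𝒟 →ₗ[ℂ] H} (hj : DenseRange j)
    {q : ℝ → 𝒟 → 𝒟 → ℂ} (hq : ∀ lam u v, q lam u v = inner ℂ (j v) (L u + (lam : ℂ) • j u))
    {lam₀ : ℝ} (hs : ∀ u, q lam₀ u u ∈ cone) :
    ∃ (A : H →ₗ.[ℂ] H) (S : ℝ → H →L[ℂ] H),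
      (∀ φ : 𝒟, (j φ, L φ) ∈ A.graph) ∧ IsAnalyticSemigroup S ∧ IsGenerator S (-A) ∧
      ∀ lam : ℝ, lam₀ ≤ lam →
        Accretive (q lam) ∧ ContinuousForm j (q lam) ∧ Closable j (q lam) ∧
        (∀ u ∈ closureDomain j (q lam), ∀ v ∈ closureDomain j (q lam),
          ∃! c : ℂ, ClosureValue j (q lam) u v c) ∧
        ∃ (Alam : H →ₗ.[ℂ] H) (T : ℝ → H →L[ℂ] H),
          (∀ u f : H, (u, f) ∈ Alam.graph ↔ AssociatedGraph j (q lam) u f) ∧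
          IsAnalyticContractionSemigroup T ∧ IsGenerator T (-Alam) ∧
          (∀ u f : H, (u, f) ∈ A.graph ↔ (u, f + (lam : ℂ) • u) ∈ Alam.graph) ∧
          ∀ t : ℝ, 0 ≤ t → S t = (Real.exp (lam * t) : ℂ) • T t := by
  have hclos : ∀ lam : ℝ, lam₀ ≤ lam → ∃ (V : Type _) (_ : NormedAddCommGroup V)
      (_ : InnerProductSpace ℂ V) (_ : CompleteSpace V) (c : 𝒟 →ₗ[ℂ] V) (ι : V →L[ℂ] H)
      (T : V →L[ℂ] V), IsFormClosure j (L + (lam : ℂ) • j) c ι T := fun lam hlam => by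
    refine exists_isFormClosure hj fun u => ?_
    have h1 : inner ℂ (j u) ((L + (lam : ℂ) • j) u)
        = q lam₀ u u + (((lam - lam₀) * ‖j u‖ ^ 2 : ℝ) : ℂ) := by
      rw [hq, LinearMap.add_apply, LinearMap.smul_apply, inner_add_right, inner_add_right,
        inner_smul_right, inner_smul_right, inner_self_eq_norm_sq_to_K]
      push_cast
      rw [RCLike.ofReal_eq_complex_ofReal]
      ring
    rw [h1]
    exact ofReal_add_mem_cone (hs u) (mul_nonneg (sub_nonneg.2 hlam) (sq_nonneg _))
  have hq' : ∀ lam u v, q lam u v = inner ℂ (j v) ((L + (lam : ℂ) • j) u) := hq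
  have hacc : ∀ lam, lam₀ ≤ lam → Accretive (q lam) := fun lam hlam u => by
    obtain ⟨V, _, _, _, c, ι, T, h⟩ := hclos lam hlam
    rw [hq']
    exact (abs_nonneg _).trans (h.mem_cone u)
  obtain ⟨V, _, _, _, c, ι, T, h⟩ := hclos lam₀ le_rfl
  obtain ⟨T₀, hT₀, hgen⟩ := h.isMSectorialGraph.exists_semigroup
  have hgraph : ∀ a : ℂ, ∀ u f : H, (u, f) ∈ (shiftGraph h.graph a).toLinearPMap.graph ↔
      (u, f + a • u) ∈ h.graph := fun a u f => by
    rw [Submodule.toLinearPMap_graph_eq, mem_shiftGraph]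
    rintro ⟨u, f⟩ hx (rfl : u = 0)
    rw [mem_shiftGraph, smul_zero, add_zero] at hx
    exact h.eq_zero_of_mem_graph hx
  have hgen' : ∀ a : ℝ, IsGenerator (fun t => (Real.exp (a * t) : ℂ) • T₀ t)
      (-(shiftGraph h.graph a).toLinearPMap) := fun a u w => by
    have e : -(w - (a : ℂ) • u) = -w + (a : ℂ) • u := by module
    rw [tendsto_slope_exp_smul_iff hT₀.1, mem_graph_neg, hgraph, ← hgen, e]
  refine ⟨(shiftGraph h.graph lam₀).toLinearPMap, fun t => (Real.exp (lam₀ * t) : ℂ) • T₀ t,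
    fun φ => ?_, ⟨hT₀.1.exp_smul lam₀, ?_⟩, hgen' lam₀, fun lam hlam => ?_⟩
  · rw [hgraph]
    exact h.mem_graph_map φ
  · obtain ⟨-, -, θ, S, hS, -⟩ := hT₀
    exact ⟨θ, _, hS.exp_smul lam₀⟩
  have hcast : ((lam₀ - lam : ℝ) : ℂ) = (lam₀ : ℂ) - lam := by push_cast; rfl
  obtain ⟨V', _, _, _, c', ι', T', h'⟩ := hclos lam hlam
  refine ⟨hacc lam hlam, h'.continuousForm (hq' lam), h'.closable (hq' lam), fun u hu v hv => ?_,
    (shiftGraph h.graph (lam₀ - lam : ℝ)).toLinearPMap,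
    fun t => (Real.exp ((lam₀ - lam) * t) : ℂ) • T₀ t, fun u f => ?_,
    hT₀.exp_smul (sub_nonpos.2 hlam), hgen' _, fun u f => ?_, fun t _ => ?_⟩
  · obtain ⟨x, rfl⟩ := (h'.mem_closureDomain_iff (hq' lam)).1 hu
    obtain ⟨y, rfl⟩ := (h'.mem_closureDomain_iff (hq' lam)).1 hv
    exact ⟨_, (h'.closureValue_iff (hq' lam)).2 rfl,
      fun z hz => ((h'.closureValue_iff (hq' lam)).1 hz).symm⟩
  · rw [hgraph, h.mem_graph_iff_associatedGraph (hq' lam₀),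
      ← associatedGraph_shift (q' := q lam) (sub_nonneg.2 hlam) (fun u v => ?_) (hacc lam₀ le_rfl)]
    · have e : f + ((lam₀ - lam : ℝ) : ℂ) • u + ((lam - lam₀ : ℝ) : ℂ) • u = f := by
        push_cast; module
      rw [e]
    · rw [hq, hq, inner_add_right, inner_add_right, inner_smul_right, inner_smul_right]
      push_cast
      ring
  · rw [hgraph, hgraph, hcast]
    have e : f + (lam : ℂ) • u + ((lam₀ : ℂ) - lam) • u = f + (lam₀ : ℂ) • u := by module
    rw [e]
  · simp only [smul_smul, ← Complex.ofReal_mul, ← Real.exp_add]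
    congr 3
    ring

end ShiftForm

/-! ### Calculus away from the origin -/

section Calculus

open scoped ContDiff

variable {N : ℕ} {F : Type*} [NormedAddCommGroup F] [NormedSpace ℝ F]

/-- The `i`-th partial derivative. -/
noncomputable def pderiv (i : Fin N) (f : Space N → F) (x : Space N) : F :=
  fderiv ℝ f x (EuclideanSpace.single i 1)

/-- Smoothness away from the origin. -/
def SmoothOff (w : Space N → F) : Prop := ∀ x ≠ 0, ContDiffAt ℝ ∞ w x

/-- The predicate defining `C_c^∞(ℝ^N \ {0})`. -/
structure IsTest (f : Space N → F) : Prop where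
  contDiff : ContDiff ℝ ∞ f
  compact : HasCompactSupport f
  zero_notMem : (0 : Space N) ∉ tsupport f

lemma Test.isTest (u : Test N) : IsTest ⇑u where
  contDiff := u.contDiff
  compact := u.hasCompactSupport
  zero_notMem h := u.tsupport_subset h rfl

/-- The bundled test function given by a function that satisfies `IsTest`. -/
def IsTest.toTest {f : Space N → ℂ} (hf : IsTest f) : Test N :=
  ⟨f, hf.contDiff, hf.compact, fun x hx hx0 => hf.zero_notMem (by
    rw [Set.mem_singleton_iff] at hx0; rwa [← hx0])⟩

lemma IsTest.smoothOff {f : Space N → F} (hf : IsTest f) : SmoothOff f :=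
  fun _ _ => hf.contDiff.contDiffAt

lemma IsTest.eventually_eq_zero {f : Space N → F} (hf : IsTest f) : f =ᶠ[𝓝 0] 0 :=
  notMem_tsupport_iff_eventuallyEq.1 hf.zero_notMem

lemma IsTest.map_zero {f : Space N → F} (hf : IsTest f) : f 0 = 0 :=
  hf.eventually_eq_zero.self_of_nhds

lemma IsTest.integrable {f : Space N → F} (hf : IsTest f) : Integrable f :=
  hf.contDiff.continuous.integrable_of_hasCompactSupport hf.compact

lemma SmoothOff.pderiv {w : Space N → F} (hw : SmoothOff w) (i : Fin N) :
    SmoothOff (pderiv i w) := fun x hx =>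
  ((hw x hx).fderiv_right (m := ∞) (by simp)).clm_apply contDiffAt_const

lemma SmoothOff.differentiableAt {w : Space N → F} (hw : SmoothOff w) {x : Space N} (hx : x ≠ 0) :
    DifferentiableAt ℝ w x := (hw x hx).differentiableAt (by simp)

lemma SmoothOff.mul {w g : Space N → ℂ} (hw : SmoothOff w) (hg : SmoothOff g) :
    SmoothOff fun x => w x * g x := fun x hx => (hw x hx).mul (hg x hx)

lemma SmoothOff.add {w g : Space N → F} (hw : SmoothOff w) (hg : SmoothOff g) :
    SmoothOff fun x => w x + g x := fun x hx => (hw x hx).add (hg x hx)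

lemma SmoothOff.ofReal {w : Space N → ℝ} (hw : SmoothOff w) :
    SmoothOff fun x => (w x : ℂ) := fun x hx =>
  Complex.ofRealCLM.contDiff.contDiffAt.comp x (hw x hx)

lemma IsTest.pderiv {f : Space N → F} (hf : IsTest f) (i : Fin N) : IsTest (pderiv i f) where
  contDiff := (hf.contDiff.fderiv_right (m := ∞) (by simp)).clm_apply contDiff_const
  compact := hf.compact.fderiv_apply ℝ _
  zero_notMem h := hf.zero_notMem (tsupport_fderiv_apply_subset ℝ _ h)

lemma IsTest.mul_left {f w : Space N → ℂ} (hf : IsTest f) (hw : SmoothOff w) :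
    IsTest fun x => w x * f x where
  contDiff := contDiff_iff_contDiffAt.2 fun x => by
    rcases eq_or_ne x 0 with rfl | hx
    · refine (contDiffAt_const (c := (0 : ℂ))).congr_of_eventuallyEq ?_
      filter_upwards [hf.eventually_eq_zero] with y hy
      simp [hy]
    · exact (hw x hx).mul hf.contDiff.contDiffAt
  compact := hf.compact.mul_left
  zero_notMem h := hf.zero_notMem (tsupport_mul_subset_right h)

lemma IsTest.add {f g : Space N → F} (hf : IsTest f) (hg : IsTest g) :
    IsTest fun x => f x + g x where
  contDiff := hf.contDiff.add hg.contDiff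
  compact := hf.compact.add hg.compact
  zero_notMem h := (tsupport_add f g h).elim hf.zero_notMem hg.zero_notMem

lemma IsTest.sum {ι : Type*} (s : Finset ι) {f : ι → Space N → ℂ} (hf : ∀ i ∈ s, IsTest (f i)) :
    IsTest fun x => ∑ i ∈ s, f i x := by
  classical
  induction s using Finset.induction_on with
  | empty =>
    simp only [Finset.sum_empty]
    exact ⟨contDiff_const, HasCompactSupport.zero, by simp [tsupport]⟩
  | insert a s ha ih =>
    simp only [Finset.sum_insert ha]
    exact (hf a (by simp)).add (ih fun i hi => hf i (by simp [hi]))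

lemma IsTest.comp_clm {G : Type*} [NormedAddCommGroup G] [NormedSpace ℝ G] {f : Space N → F}
    (hf : IsTest f) (l : F →L[ℝ] G) : IsTest fun x => l (f x) where
  contDiff := l.contDiff.comp hf.contDiff
  compact := hf.compact.comp_left (g := l) (_root_.map_zero l)
  zero_notMem h := hf.zero_notMem (tsupport_comp_subset (_root_.map_zero l) f h)

lemma IsTest.conj {f : Space N → ℂ} (hf : IsTest f) : IsTest fun x => starRingEnd ℂ (f x) :=
  hf.comp_clm (Complex.conjCLE : ℂ →L[ℝ] ℂ)

lemma two_le_infty : (2 : WithTop ℕ∞) ≤ ∞ := WithTop.coe_le_coe.2 le_top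

lemma laplacian_eq_sum_pderiv {f : Space N → F} {x : Space N} (hf : ContDiffAt ℝ 2 f x) :
    Laplacian.laplacian f x = ∑ i, pderiv i (pderiv i f) x := by
  rw [InnerProductSpace.laplacian_eq_iteratedFDeriv_orthonormalBasis f
    (EuclideanSpace.basisFun (Fin N) ℝ)]
  refine Finset.sum_congr rfl fun i _ => ?_
  have hd : DifferentiableAt ℝ (fderiv ℝ f) x :=
    (hf.fderiv_right (m := 1) (by norm_num)).differentiableAt (by simp)
  rw [iteratedFDeriv_two_apply]
  simp only [Matrix.cons_val_zero, Matrix.cons_val_one, EuclideanSpace.basisFun_apply, pderiv]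
  change _ = fderiv ℝ (fun y => fderiv ℝ f y (EuclideanSpace.single i 1)) x _
  rw [fderiv_clm_apply hd (differentiableAt_const _)]
  simp

lemma SmoothOff.laplacian_eq {w : Space N → F} (hw : SmoothOff w) {x : Space N} (hx : x ≠ 0) :
    Laplacian.laplacian w x = ∑ i, BiLaplace.pderiv i (BiLaplace.pderiv i w) x :=
  laplacian_eq_sum_pderiv ((hw x hx).of_le (two_le_infty))

lemma IsTest.laplacian_eq {f : Space N → F} (hf : IsTest f) (x : Space N) :
    Laplacian.laplacian f x = ∑ i, BiLaplace.pderiv i (BiLaplace.pderiv i f) x :=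
  laplacian_eq_sum_pderiv (hf.contDiff.contDiffAt.of_le (two_le_infty))

lemma IsTest.laplacian {f : Space N → ℂ} (hf : IsTest f) :
    IsTest (Laplacian.laplacian f : Space N → ℂ) := by
  have h := IsTest.sum Finset.univ fun (i : Fin N) _ => (hf.pderiv i).pderiv i
  convert h using 2 with x
  exact hf.laplacian_eq x

lemma pderiv_mul {f g : Space N → ℂ} {x : Space N} (hf : DifferentiableAt ℝ f x)
    (hg : DifferentiableAt ℝ g x) (i : Fin N) :
    pderiv i (fun y => f y * g y) x = f x * pderiv i g x + pderiv i f x * g x := by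
  simp only [pderiv]
  rw [fderiv_fun_mul hf hg]
  simp only [add_apply, smul_apply, smul_eq_mul]
  ring

lemma pderiv_congr {f g : Space N → F} {x : Space N} (h : f =ᶠ[𝓝 x] g) (i : Fin N) :
    pderiv i f x = pderiv i g x := by
  rw [pderiv, pderiv, h.fderiv_eq]

lemma pderiv_add {f g : Space N → F} {x : Space N} (hf : DifferentiableAt ℝ f x)
    (hg : DifferentiableAt ℝ g x) (i : Fin N) :
    pderiv i (fun y => f y + g y) x = pderiv i f x + pderiv i g x := by
  simp only [pderiv]
  rw [fderiv_fun_add hf hg, add_apply]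

lemma pderiv_comp_clm {G : Type*} [NormedAddCommGroup G] [NormedSpace ℝ G] {f : Space N → F}
    {x : Space N} (hf : DifferentiableAt ℝ f x) (l : F →L[ℝ] G) (i : Fin N) :
    pderiv i (fun y => l (f y)) x = l (pderiv i f x) := by
  simp only [pderiv]
  have := (l.hasFDerivAt.comp x hf.hasFDerivAt).fderiv
  rw [show (fun y => l (f y)) = l ∘ f from rfl, this]
  rfl

/-- The Leibniz rule `Δ(fg) = f Δg + 2 ∇f·∇g + g Δf` away from the origin. -/
lemma laplacian_mul {f g : Space N → ℂ} (hf : SmoothOff f) (hg : SmoothOff g) {x : Space N}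
    (hx : x ≠ 0) :
    Laplacian.laplacian (fun y => f y * g y) x = f x * Laplacian.laplacian g x
      + 2 * ∑ i, pderiv i f x * pderiv i g x + Laplacian.laplacian f x * g x := by
  rw [(hf.mul hg).laplacian_eq hx, hf.laplacian_eq hx, hg.laplacian_eq hx, Finset.mul_sum,
    Finset.mul_sum, Finset.sum_mul, ← Finset.sum_add_distrib, ← Finset.sum_add_distrib]
  refine Finset.sum_congr rfl fun i _ => ?_
  have h1 : pderiv i (fun y => f y * g y)
      =ᶠ[𝓝 x] fun y => f y * pderiv i g y + pderiv i f y * g y := by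
    filter_upwards [isOpen_compl_singleton.mem_nhds (Set.mem_compl_singleton_iff.2 hx)] with y hy
    exact pderiv_mul (hf.differentiableAt hy) (hg.differentiableAt hy) i
  rw [pderiv_congr h1, pderiv_add ((hf.mul (hg.pderiv i)).differentiableAt hx)
    (((hf.pderiv i).mul hg).differentiableAt hx), pderiv_mul (hf.differentiableAt hx)
    ((hg.pderiv i).differentiableAt hx), pderiv_mul ((hf.pderiv i).differentiableAt hx)
    (hg.differentiableAt hx)]
  ring

lemma integral_mul_pderiv {w g : Space N → ℂ} (hw : SmoothOff w) (hg : IsTest g) (i : Fin N) :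
    ∫ x, w x * pderiv i g x = -∫ x, pderiv i w x * g x := by
  refine integral_mul_fderiv_eq_neg_fderiv_mul_of_integrable
    (hg.mul_left (hw.pderiv i)).integrable ((hg.pderiv i).mul_left hw).integrable
    (hg.mul_left hw).integrable (fun x hx => hw.differentiableAt ?_)
    (fun x _ => hg.contDiff.contDiffAt.differentiableAt (by simp))
  rintro rfl
  exact hg.zero_notMem hx

/-- Green's identity for a test function and a weight that may be singular at the origin. -/
lemma integral_mul_laplacian {w g : Space N → ℂ} (hw : SmoothOff w) (hg : IsTest g) :
    ∫ x, w x * Laplacian.laplacian g x = ∫ x, Laplacian.laplacian w x * g x := by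
  have h1 : ∀ x, w x * Laplacian.laplacian g x = ∑ i, w x * pderiv i (pderiv i g) x := fun x => by
    rw [hg.laplacian_eq, Finset.mul_sum]
  have h2 : ∀ x, Laplacian.laplacian w x * g x = ∑ i, pderiv i (pderiv i w) x * g x := fun x => by
    rcases eq_or_ne x 0 with rfl | hx
    · simp [hg.map_zero]
    · rw [hw.laplacian_eq hx, Finset.sum_mul]
  simp only [h1, h2]
  rw [integral_finsetSum _ fun i _ => (((hg.pderiv i).pderiv i).mul_left hw).integrable,
    integral_finsetSum _ fun i _ => (hg.mul_left ((hw.pderiv i).pderiv i)).integrable]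
  refine Finset.sum_congr rfl fun i _ => ?_
  rw [integral_mul_pderiv hw (hg.pderiv i), integral_mul_pderiv (hw.pderiv i) hg, neg_neg]

/-! ### Powers of `|x|` -/

lemma hasFDerivAt_norm_rpow_off (s : ℝ) {x : Space N} (hx : x ≠ 0) :
    HasFDerivAt (fun y : Space N => ‖y‖ ^ s) ((s * ‖x‖ ^ (s - 2)) • innerSL ℝ x) x := by
  have h0 : 0 < ‖x‖ := norm_pos_iff.2 hx
  have h1 : HasFDerivAt (fun y : Space N => ‖y‖ ^ 2) (2 • innerSL ℝ x) x :=
    (hasStrictFDerivAt_norm_sq x).hasFDerivAt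
  have h2 := h1.rpow_const (p := s / 2) (Or.inl (by positivity))
  have e1 : (fun y : Space N => ‖y‖ ^ s) = fun y => (‖y‖ ^ 2) ^ (s / 2) := by
    funext y
    rw [← Real.rpow_natCast_mul (norm_nonneg y)]
    congr 1; push_cast; ring
  rw [e1]
  refine h2.congr_fderiv ?_
  rw [← Real.rpow_natCast_mul (norm_nonneg x), two_smul, ← two_smul ℝ, smul_smul]
  congr 1
  rw [show ((2 : ℕ) : ℝ) * (s / 2 - 1) = s - 2 by push_cast; ring]
  ring

lemma smoothOff_norm_rpow (s : ℝ) : SmoothOff fun x : Space N => ‖x‖ ^ s := fun _ hx =>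
  (contDiffAt_norm ℝ hx).rpow_const_of_ne (norm_ne_zero_iff.2 hx)

lemma pderiv_norm_rpow (s : ℝ) {x : Space N} (hx : x ≠ 0) (i : Fin N) :
    pderiv i (fun y : Space N => ‖y‖ ^ s) x = s * ‖x‖ ^ (s - 2) * x i := by
  rw [pderiv, (hasFDerivAt_norm_rpow_off s hx).fderiv]
  simp [EuclideanSpace.inner_single_right]

lemma laplacian_norm_rpow (s : ℝ) {x : Space N} (hx : x ≠ 0) :
    Laplacian.laplacian (fun y : Space N => ‖y‖ ^ s) x = s * (s + N - 2) * ‖x‖ ^ (s - 2) := by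
  rw [(smoothOff_norm_rpow s).laplacian_eq hx]
  have h0 : 0 < ‖x‖ := norm_pos_iff.2 hx
  have h1 : ∀ i, pderiv i (pderiv i fun y : Space N => ‖y‖ ^ s) x
      = s * ((s - 2) * ‖x‖ ^ (s - 2 - 2) * x i ^ 2 + ‖x‖ ^ (s - 2)) := fun i => by
    have h2 : pderiv i (fun y : Space N => ‖y‖ ^ s)
        =ᶠ[𝓝 x] fun y => s * (‖y‖ ^ (s - 2) * y i) := by
      filter_upwards [isOpen_compl_singleton.mem_nhds (Set.mem_compl_singleton_iff.2 hx)] with y hy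
      rw [pderiv_norm_rpow s hy, mul_assoc]
    rw [pderiv_congr h2, pderiv]
    have h3 : HasFDerivAt (fun y : Space N => y i) (EuclideanSpace.proj i : Space N →L[ℝ] ℝ) x :=
      (EuclideanSpace.proj i : Space N →L[ℝ] ℝ).hasFDerivAt
    have h4 : HasFDerivAt (fun y : Space N => s * (‖y‖ ^ (s - 2) * y i)) _ x :=
      ((hasFDerivAt_norm_rpow_off (s - 2) hx).mul h3).const_mul s
    rw [h4.fderiv]
    simp [EuclideanSpace.inner_single_right]
    ring
  simp only [h1]
  rw [← Finset.mul_sum, Finset.sum_add_distrib, ← Finset.mul_sum, ← EuclideanSpace.real_norm_sq_eq]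
  have h4 : ‖x‖ ^ (s - 2 - 2) * ‖x‖ ^ 2 = ‖x‖ ^ (s - 2) := by
    rw [← Real.rpow_natCast, ← Real.rpow_add h0]; congr 1; push_cast; ring
  simp only [Finset.sum_const, Finset.card_univ, Fintype.card_fin, nsmul_eq_mul]
  rw [mul_assoc (s - 2), h4]
  ring

lemma pderiv_ofReal {w : Space N → ℝ} (hw : SmoothOff w) {x : Space N} (hx : x ≠ 0) (i : Fin N) :
    pderiv i (fun y => (w y : ℂ)) x = ((pderiv i w x : ℝ) : ℂ) :=
  pderiv_comp_clm (hw.differentiableAt hx) Complex.ofRealCLM i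

lemma laplacian_ofReal {w : Space N → ℝ} (hw : SmoothOff w) {x : Space N} (hx : x ≠ 0) :
    Laplacian.laplacian (fun y => (w y : ℂ)) x = (Laplacian.laplacian w x : ℂ) :=
  ContDiffAt.laplacian_CLM_comp_left (l := Complex.ofRealCLM)
    ((hw x hx).of_le (two_le_infty))

lemma IsTest.laplacian_conj {f : Space N → ℂ} (hf : IsTest f) (x : Space N) :
    Laplacian.laplacian (fun y => starRingEnd ℂ (f y)) x
      = starRingEnd ℂ (Laplacian.laplacian f x) :=
  ContDiffAt.laplacian_CLM_comp_left (l := (Complex.conjCLE : ℂ →L[ℝ] ℂ))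
    (hf.contDiff.contDiffAt.of_le (two_le_infty))

lemma IsTest.pderiv_conj {f : Space N → ℂ} (hf : IsTest f) (x : Space N) (i : Fin N) :
    BiLaplace.pderiv i (fun y => starRingEnd ℂ (f y)) x
      = starRingEnd ℂ (BiLaplace.pderiv i f x) :=
  pderiv_comp_clm (hf.contDiff.contDiffAt.differentiableAt (by simp))
    (Complex.conjCLE : ℂ →L[ℝ] ℂ) i

/-- The derivative along a gradient in coordinates. -/
lemma fderiv_gradient (v : Space N → ℂ) (w : Space N → ℝ) (x : Space N) :
    fderiv ℝ v x (gradient w x) = ∑ i, ((pderiv i w x : ℝ) : ℂ) * pderiv i v x := by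
  have h : gradient w x = ∑ i, pderiv i w x • (EuclideanSpace.single i (1 : ℝ) : Space N) := by
    rw [← (EuclideanSpace.basisFun (Fin N) ℝ).sum_repr' (gradient w x)]
    refine Finset.sum_congr rfl fun i _ => ?_
    rw [real_inner_comm, gradient, InnerProductSpace.toDual_symm_apply,
      EuclideanSpace.basisFun_apply, pderiv]
  rw [h, map_sum]
  refine Finset.sum_congr rfl fun i _ => ?_
  rw [map_smul, Complex.real_smul, pderiv, pderiv]

end Calculus

/-! ### The operator on test functions and its form -/

section Operator

open scoped ContDiff

variable {N : ℕ}

lemma SmoothOff.laplacian {w : Space N → ℂ} (hw : SmoothOff w) :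
    SmoothOff (Laplacian.laplacian w : Space N → ℂ) := fun x hx => by
  have h : ContDiffAt ℝ ∞ (fun y => ∑ i, BiLaplace.pderiv i (BiLaplace.pderiv i w) y) x :=
    ContDiffAt.sum fun i _ => ((hw.pderiv i).pderiv i) x hx
  refine h.congr_of_eventuallyEq ?_
  filter_upwards [isOpen_compl_singleton.mem_nhds (Set.mem_compl_singleton_iff.2 hx)] with y hy
  exact hw.laplacian_eq hy

lemma rpow_mul_self_sq (s : ℝ) (x : Space N) : (‖x‖ ^ s) ^ 2 = ‖x‖ ^ (2 * s) := by
  rw [← Real.rpow_mul_natCast (norm_nonneg x)]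
  congr 1; push_cast; ring

lemma aSq_eq (α : ℝ) (x : Space N) : aSq α x = 1 + 2 * ‖x‖ ^ α + ‖x‖ ^ (2 * α) := by
  rw [aSq, ← rpow_mul_self_sq]; ring

lemma smoothOff_aSq (α : ℝ) : SmoothOff (aSq (N := N) α) := fun x hx =>
  ((contDiffAt_const (c := (1 : ℝ))).add (smoothOff_norm_rpow α x hx)).pow 2

lemma smoothOff_V_sq (β : ℝ) : SmoothOff (fun x : Space N => (V β x) ^ 2) := fun x hx =>
  (smoothOff_norm_rpow β x hx).pow 2

lemma isTest_diffExpr (α β : ℝ) {u : Space N → ℂ} (hu : IsTest u) : IsTest (diffExpr α β u) :=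
  (hu.laplacian.laplacian.mul_left (smoothOff_aSq α).ofReal).add
    (hu.mul_left (smoothOff_V_sq β).ofReal)

lemma IsTest.laplacian_add {u v : Space N → ℂ} (hu : IsTest u) (hv : IsTest v) :
    (Laplacian.laplacian (u + v) : Space N → ℂ)
      = Laplacian.laplacian u + Laplacian.laplacian v := by
  funext x
  exact ContDiffAt.laplacian_add (hu.contDiff.contDiffAt.of_le two_le_infty)
    (hv.contDiff.contDiffAt.of_le two_le_infty)

lemma IsTest.laplacian_smul {u : Space N → ℂ} (hu : IsTest u) (a : ℂ) :
    (Laplacian.laplacian (a • u) : Space N → ℂ) = a • Laplacian.laplacian u := by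
  funext x
  exact ContDiffAt.laplacian_CLM_comp_left (l := (a • ContinuousLinearMap.id ℝ ℂ : ℂ →L[ℝ] ℂ))
    (hu.contDiff.contDiffAt.of_le two_le_infty)

/-- The operator `a² Δ² + V²` as a linear map on `C_c^∞(ℝ^N \ {0})`. -/
noncomputable def diffOp (α β : ℝ) : Test N →ₗ[ℂ] Test N where
  toFun u := (isTest_diffExpr α β u.isTest).toTest
  map_add' u v := TestFunction.ext fun x => by
    change diffExpr α β (⇑u + ⇑v) x = diffExpr α β u x + diffExpr α β v x
    rw [diffExpr, u.isTest.laplacian_add v.isTest,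
      u.isTest.laplacian.laplacian_add v.isTest.laplacian]
    simp only [diffExpr, Pi.add_apply]
    ring
  map_smul' a u := TestFunction.ext fun x => by
    change diffExpr α β (a • ⇑u) x = a • diffExpr α β u x
    rw [diffExpr, u.isTest.laplacian_smul, u.isTest.laplacian.laplacian_smul]
    simp only [diffExpr, Pi.smul_apply, smul_eq_mul]
    ring

lemma coe_diffOp (α β : ℝ) (u : Test N) : ⇑(diffOp α β u) = diffExpr α β u := rfl

/-- The embedding of `C_c^∞(ℝ^N \ {0})` into `L²` as a linear map. -/
noncomputable def toL2Lin : Test N →ₗ[ℂ] L2 N where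
  toFun := toL2
  map_add' _ _ := rfl
  map_smul' _ _ := rfl

lemma coeFn_toL2 (u : Test N) : (toL2 u : Space N → ℂ) =ᵐ[volume] u := MemLp.coeFn_toLp _

lemma inner_toL2 (u v : Test N) :
    inner ℂ (toL2 v) (toL2 u) = ∫ x, starRingEnd ℂ (v x) * u x := by
  rw [L2.inner_def]
  refine integral_congr_ae ?_
  filter_upwards [coeFn_toL2 u, coeFn_toL2 v] with x hu hv
  rw [hu, hv, RCLike.inner_apply, mul_comm]

/-- The orthogonal complement of the test functions vanishes almost everywhere off the origin, which
is a null set in positive dimension. -/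
lemma denseRange_toL2 (hN : 0 < N) : DenseRange (toL2 : Test N → L2 N) := by
  have h : Dense (LinearMap.range (toL2Lin : Test N →ₗ[ℂ] L2 N) : Set (L2 N)) := by
    rw [Submodule.dense_iff_topologicalClosure_eq_top,
      Submodule.topologicalClosure_eq_top_iff, Submodule.eq_bot_iff]
    intro f hf
    rw [Submodule.mem_orthogonal] at hf
    have : Nonempty (Fin N) := ⟨⟨0, hN⟩⟩
    have h0 := (punctured N).isOpen.ae_eq_zero_of_integral_contDiff_smul_eq_zero
      (μ := (volume : Measure (Space N))) (f := f)
      (((Lp.memLp f).locallyIntegrable one_le_two).locallyIntegrableOn _) fun g hg hgc hgs => by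
        have hgt : IsTest g := ⟨hg, hgc, fun h => hgs h rfl⟩
        let φ : Test N := (hgt.comp_clm Complex.ofRealCLM).toTest
        have h1 := hf (toL2 φ) ⟨φ, rfl⟩
        rw [L2.inner_def] at h1
        rw [← h1]
        refine integral_congr_ae ?_
        filter_upwards [coeFn_toL2 φ] with x hx
        rw [hx, RCLike.inner_apply']
        change g x • f x = starRingEnd ℂ ((g x : ℝ) : ℂ) * f x
        rw [Complex.conj_ofReal, Complex.real_smul]
    rw [Lp.eq_zero_iff_ae_eq_zero]
    have h2 : ∀ᵐ x : Space N, x ≠ 0 := by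
      simp [ae_iff]
    filter_upwards [h0, h2] with x hx hx0
    exact hx hx0
  exact h

/-- The integrand of the lower order part of the form. -/
noncomputable def lowerOrder (α : ℝ) (u v : Space N → ℂ) (x : Space N) : ℂ :=
  2 * starRingEnd ℂ (fderiv ℝ v x (gradient (aSq α) x)) * Laplacian.laplacian u x
    + (Laplacian.laplacian (aSq (N := N) α) x : ℂ) * Laplacian.laplacian u x
      * starRingEnd ℂ (v x)

/-- The Leibniz rule for `Δ(a² v̄)`, multiplied by `Δu`, gives the integrand of the form. -/
lemma laplacian_aSq_mul_conj (α : ℝ) {u v : Space N → ℂ} (hu : IsTest u) (hv : IsTest v)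
    (x : Space N) :
    Laplacian.laplacian (fun y => (aSq α y : ℂ) * starRingEnd ℂ (v y)) x * Laplacian.laplacian u x
      = (aSq α x : ℂ) * starRingEnd ℂ (Laplacian.laplacian v x) * Laplacian.laplacian u x
        + lowerOrder α u v x := by
  rcases eq_or_ne x 0 with rfl | hx
  · simp [lowerOrder, hu.laplacian.map_zero]
  · rw [laplacian_mul (smoothOff_aSq α).ofReal hv.conj.smoothOff hx,
      laplacian_ofReal (smoothOff_aSq α) hx, hv.laplacian_conj, lowerOrder, fderiv_gradient]
    simp only [pderiv_ofReal (smoothOff_aSq α) hx, hv.pderiv_conj, map_sum, map_mul,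
      Complex.conj_ofReal]
    ring

lemma isTest_lowerOrder (α : ℝ) {u v : Space N → ℂ} (hu : IsTest u) (hv : IsTest v) :
    IsTest (lowerOrder α u v) := by
  have hw : SmoothOff fun y => (aSq α y : ℂ) * starRingEnd ℂ (v y) :=
    (smoothOff_aSq α).ofReal.mul hv.conj.smoothOff
  have h1 := hu.laplacian.mul_left hw.laplacian
  have h2 := hu.laplacian.mul_left
    ((smoothOff_aSq α).ofReal.mul hv.laplacian.conj.smoothOff)
  have h3 := h1.add (h2.mul_left (w := fun _ => -1) fun _ _ => contDiffAt_const)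
  convert h3 using 2 with x
  rw [laplacian_aSq_mul_conj α hu hv]
  ring

/-- Green's identity: the terms `2 (∇a² · ∇v̄) Δu + (Δa²) v̄ Δu` are what moving one Laplacian of
`Δ² u` onto `a² v̄` produces beside `a² Δu Δv̄`. -/
lemma form_eq_inner (α β lam : ℝ) (u v : Test N) :
    form α β lam u v = inner ℂ (toL2 v) (toL2 (diffOp α β u) + (lam : ℂ) • toL2 u) := by
  have hu := u.isTest
  have hv := v.isTest
  have hw : SmoothOff fun y => (aSq α y : ℂ) * starRingEnd ℂ (v y) :=
    (smoothOff_aSq α).ofReal.mul hv.conj.smoothOff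
  have hV : IsTest fun x => ((V β x ^ 2 + lam : ℝ) : ℂ) * u x * starRingEnd ℂ (v x) := by
    have h := ((hv.conj.mul_left hu.smoothOff).mul_left (w := fun x => ((V β x ^ 2 + lam : ℝ) : ℂ))
      (SmoothOff.ofReal ((smoothOff_V_sq β).add fun _ _ => contDiffAt_const)))
    convert h using 2
    ring
  have h1 := integral_mul_laplacian hw hu.laplacian
  rw [inner_add_right, inner_smul_right, inner_toL2, inner_toL2, ← integral_const_mul,
    ← integral_add (((diffOp α β u).isTest.mul_left hv.conj.smoothOff).integrable)
    ((hu.mul_left hv.conj.smoothOff).integrable.const_mul _)]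
  have e1 : ∀ x, starRingEnd ℂ (v x) * diffOp α β u x + lam * (starRingEnd ℂ (v x) * u x)
      = (aSq α x : ℂ) * starRingEnd ℂ (v x) * Laplacian.laplacian (Laplacian.laplacian ⇑u) x
        + ((V β x ^ 2 + lam : ℝ) : ℂ) * u x * starRingEnd ℂ (v x) := fun x => by
    rw [coe_diffOp, diffExpr]; push_cast; ring
  simp only [e1]
  rw [integral_add (hu.laplacian.laplacian.mul_left hw).integrable hV.integrable, h1, form,
    ← integral_add (hu.laplacian.mul_left hw.laplacian).integrable hV.integrable]
  refine integral_congr_ae (Eventually.of_forall fun x => ?_)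
  simp only [laplacian_aSq_mul_conj α hu hv x, lowerOrder]
  ring

end Operator

/-! ### Weighted inequalities -/

section Inequalities

variable {N : ℕ}

/-- The squared Euclidean norm of the gradient. -/
noncomputable def gradSq (u : Space N → ℂ) (x : Space N) : ℝ := ∑ i, ‖pderiv i u x‖ ^ 2

lemma integrable_mul_normSq {w : Space N → ℝ} (hw : SmoothOff w) {u : Space N → ℂ}
    (hu : IsTest u) : Integrable fun x => w x * ‖u x‖ ^ 2 := by
  have h := ((hu.conj.mul_left hu.smoothOff).mul_left hw.ofReal).integrable.re
  refine h.congr (Eventually.of_forall fun x => ?_)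
  change ((w x : ℂ) * (u x * starRingEnd ℂ (u x))).re = _
  rw [Complex.re_ofReal_mul, Complex.mul_conj']
  norm_cast

lemma integrable_normSq {u : Space N → ℂ} (hu : IsTest u) : Integrable fun x => ‖u x‖ ^ 2 := by
  simpa using integrable_mul_normSq (w := fun _ => 1) (fun _ _ => contDiffAt_const) hu

lemma integrable_mul_gradSq {w : Space N → ℝ} (hw : SmoothOff w) {u : Space N → ℂ}
    (hu : IsTest u) : Integrable fun x => w x * gradSq u x := by
  simp only [gradSq, Finset.mul_sum]
  exact integrable_finsetSum _ fun i _ => integrable_mul_normSq hw (hu.pderiv i)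

lemma laplacian_mul_conj_self {u : Space N → ℂ} (hu : IsTest u) (x : Space N) :
    Laplacian.laplacian (fun y => u y * starRingEnd ℂ (u y)) x
      = ((2 * (starRingEnd ℂ (u x) * Laplacian.laplacian u x).re + 2 * gradSq u x : ℝ) : ℂ) := by
  rcases eq_or_ne x 0 with rfl | hx
  · have h1 : ∀ i, pderiv i u 0 = 0 := fun i => (hu.pderiv i).map_zero
    simp [(hu.conj.mul_left hu.smoothOff).laplacian.map_zero, hu.map_zero, gradSq, h1]
  · rw [laplacian_mul hu.smoothOff hu.conj.smoothOff hx, hu.laplacian_conj]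
    have h1 : ∀ i, pderiv i u x * pderiv i (fun y => starRingEnd ℂ (u y)) x
        = ((‖pderiv i u x‖ ^ 2 : ℝ) : ℂ) := fun i => by
      rw [hu.pderiv_conj, Complex.mul_conj']; push_cast; rfl
    simp only [h1, gradSq]
    have h2 : (((starRingEnd ℂ (u x) * Laplacian.laplacian u x).re : ℝ) : ℂ)
        = (starRingEnd ℂ (u x) * Laplacian.laplacian u x
          + u x * starRingEnd ℂ (Laplacian.laplacian u x)) / 2 := by
      rw [Complex.re_eq_add_conj, map_mul, Complex.conj_conj]
    push_cast
    rw [h2]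
    ring

/-- Integration by parts against a power of `|x|`:
`∫ |x|^s |∇u|² = (s (s + N - 2) / 2) ∫ |x|^(s-2) |u|² - ∫ |x|^s Re (ū Δu)`. -/
lemma integral_rpow_mul_gradSq (s : ℝ) {u : Space N → ℂ} (hu : IsTest u) :
    ∫ x, ‖x‖ ^ s * gradSq u x = s * (s + N - 2) / 2 * (∫ x, ‖x‖ ^ (s - 2) * ‖u x‖ ^ 2)
      - ∫ x, ‖x‖ ^ s * (starRingEnd ℂ (u x) * Laplacian.laplacian u x).re := by
  have hs := smoothOff_norm_rpow (N := N) s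
  have hg : IsTest fun x => u x * starRingEnd ℂ (u x) := hu.conj.mul_left hu.smoothOff
  have hgreen := integral_mul_laplacian hs.ofReal hg
  have e1 : ∀ x, ((‖x‖ ^ s : ℝ) : ℂ) * Laplacian.laplacian (fun y => u y * starRingEnd ℂ (u y)) x
      = ((2 * (‖x‖ ^ s * (starRingEnd ℂ (u x) * Laplacian.laplacian u x).re)
        + 2 * (‖x‖ ^ s * gradSq u x) : ℝ) : ℂ) := fun x => by
    rw [laplacian_mul_conj_self hu]; push_cast; ring
  have e2 : ∀ x, Laplacian.laplacian (fun y : Space N => ((‖y‖ ^ s : ℝ) : ℂ)) x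
      * (u x * starRingEnd ℂ (u x))
      = ((s * (s + N - 2) * (‖x‖ ^ (s - 2) * ‖u x‖ ^ 2) : ℝ) : ℂ) := fun x => by
    rcases eq_or_ne x 0 with rfl | hx
    · simp [hu.map_zero]
    · rw [laplacian_ofReal hs hx, laplacian_norm_rpow s hx, Complex.mul_conj']
      push_cast; ring
  simp only [e1, e2] at hgreen
  rw [integral_complex_ofReal, integral_complex_ofReal, Complex.ofReal_inj, integral_const_mul,
    integral_add, integral_const_mul, integral_const_mul] at hgreen
  · linarith
  · refine Integrable.const_mul ?_ _
    have h := ((hu.laplacian.mul_left hu.conj.smoothOff).mul_left hs.ofReal).integrable.re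
    refine h.congr (Eventually.of_forall fun x => ?_)
    exact Complex.re_ofReal_mul _ _
  · exact (integrable_mul_gradSq hs hu).const_mul _

/-- A Rellich inequality: testing the weighted identity with `|x|⁻²` gives
`(N - 4) ∫ |x|⁻⁴ |u|² ≤ ∫ |x|⁻² |u| |Δu|`. -/
lemma rellich (hN : 5 ≤ N) {u : Space N → ℂ} (hu : IsTest u) :
    ∫ x, ‖x‖ ^ (-4 : ℝ) * ‖u x‖ ^ 2 ≤ ∫ x, ‖Laplacian.laplacian u x‖ ^ 2 := by
  have h1 := integral_rpow_mul_gradSq (-2) hu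
  rw [show (-2 - 2 : ℝ) = -4 by norm_num] at h1
  have i1 := integrable_mul_normSq (smoothOff_norm_rpow (-4)) hu
  have i2 := integrable_normSq hu.laplacian
  have h0 : 0 ≤ ∫ x, ‖x‖ ^ (-2 : ℝ) * gradSq u x := integral_nonneg fun x =>
    mul_nonneg (by positivity) (Finset.sum_nonneg fun i _ => by positivity)
  have hZ : 0 ≤ ∫ x, ‖x‖ ^ (-4 : ℝ) * ‖u x‖ ^ 2 := integral_nonneg fun x => by positivity
  have h2 : -∫ x, ‖x‖ ^ (-2 : ℝ) * (starRingEnd ℂ (u x) * Laplacian.laplacian u x).re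
      ≤ (1 / 2) * (∫ x, ‖x‖ ^ (-4 : ℝ) * ‖u x‖ ^ 2)
        + (1 / 2) * ∫ x, ‖Laplacian.laplacian u x‖ ^ 2 := by
    rw [← integral_neg, ← integral_const_mul, ← integral_const_mul,
      ← integral_add (i1.const_mul _) (i2.const_mul _)]
    have i3 := ((hu.laplacian.mul_left hu.conj.smoothOff).mul_left
      (smoothOff_norm_rpow (-2)).ofReal).integrable.re
    refine integral_mono ?_ ((i1.const_mul _).add (i2.const_mul _)) fun x => ?_
    · exact (i3.congr (Eventually.of_forall fun x => Complex.re_ofReal_mul _ _)).neg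
    · have h3 := Complex.abs_re_le_norm (starRingEnd ℂ (u x) * Laplacian.laplacian u x)
      rw [norm_mul, RCLike.norm_conj] at h3
      have h4 := neg_abs_le (starRingEnd ℂ (u x) * Laplacian.laplacian u x).re
      have h5 : ‖x‖ ^ (-4 : ℝ) = (‖x‖ ^ (-2 : ℝ)) ^ 2 := by
        rw [rpow_mul_self_sq]; norm_num
      have h6 : 0 ≤ ‖x‖ ^ (-2 : ℝ) := by positivity
      simp only [h5]
      nlinarith [sq_nonneg (‖x‖ ^ (-2 : ℝ) * ‖u x‖ - ‖Laplacian.laplacian u x‖)]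
  have hN' : (5 : ℝ) ≤ N := by exact_mod_cast hN
  nlinarith

/-- Interpolation of powers: the exponent `2α - 4` lies strictly between `-4` and `2β`. -/
lemma exists_rpow_le {α β : ℝ} (hα : 0 < α) (hβ : α - 2 < β) {ε : ℝ} (hε : 0 < ε) :
    ∃ C, 0 ≤ C ∧ ∀ r : ℝ, 0 < r →
      r ^ (2 * α - 4) ≤ ε * r ^ (-4 : ℝ) + ε * r ^ (2 * β) + C := by
  set r₀ := ε ^ (1 / (2 * α)) with hr₀
  set r₁ := ε ^ (1 / (2 * α - 4 - 2 * β)) with hr₁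
  have hγ : 2 * α - 4 - 2 * β < 0 := by linarith
  have h0 : 0 < r₀ := Real.rpow_pos_of_pos hε _
  have h1 : 0 < r₁ := Real.rpow_pos_of_pos hε _
  obtain ⟨C, hC⟩ := isCompact_Icc.exists_bound_of_continuousOn (s := Set.Icc r₀ r₁)
    (f := fun r : ℝ => r ^ (2 * α - 4)) (ContinuousOn.rpow_const continuousOn_id fun r hr =>
      Or.inl (h0.trans_le hr.1).ne')
  refine ⟨max C 0, le_max_right _ _, fun r hr => ?_⟩
  have p1 : 0 ≤ ε * r ^ (-4 : ℝ) := by positivity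
  have p2 : 0 ≤ ε * r ^ (2 * β) := by positivity
  have p3 : 0 ≤ max C 0 := le_max_right _ _
  rcases le_total r r₀ with hle | hge
  · have h2 : r ^ (2 * α) ≤ ε := by
      have := Real.rpow_le_rpow hr.le hle (z := 2 * α) (by positivity)
      rwa [hr₀, ← Real.rpow_mul hε.le, one_div_mul_cancel (by positivity), Real.rpow_one] at this
    have h3 : r ^ (2 * α - 4) = r ^ (2 * α) * r ^ (-4 : ℝ) := by
      rw [← Real.rpow_add hr]; congr 1
    have h4 : r ^ (2 * α) * r ^ (-4 : ℝ) ≤ ε * r ^ (-4 : ℝ) := by gcongr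
    linarith
  · rcases le_total r r₁ with hle | hge'
    · have := (le_abs_self _).trans (hC r ⟨hge, hle⟩)
      have := le_max_left C 0
      linarith
    · have h2 : r ^ (2 * α - 4 - 2 * β) ≤ ε := by
        have := Real.rpow_le_rpow_of_nonpos h1 hge' hγ.le
        rwa [hr₁, ← Real.rpow_mul hε.le, one_div_mul_cancel hγ.ne, Real.rpow_one] at this
      have h3 : r ^ (2 * α - 4) = r ^ (2 * α - 4 - 2 * β) * r ^ (2 * β) := by
        rw [← Real.rpow_add hr]; congr 1; ring
      have h4 : r ^ (2 * α - 4 - 2 * β) * r ^ (2 * β) ≤ ε * r ^ (2 * β) := by gcongr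
      linarith

lemma one_le_aSq (α : ℝ) (x : Space N) : 1 ≤ aSq α x := by
  rw [aSq]
  have : 0 ≤ ‖x‖ ^ α := by positivity
  nlinarith

lemma integral_normSq_laplacian_le (α : ℝ) {u : Space N → ℂ} (hu : IsTest u) :
    ∫ x, ‖Laplacian.laplacian u x‖ ^ 2 ≤ ∫ x, aSq α x * ‖Laplacian.laplacian u x‖ ^ 2 :=
  integral_mono (integrable_normSq hu.laplacian)
    (integrable_mul_normSq (smoothOff_aSq α) hu.laplacian) fun x =>
      le_mul_of_one_le_left (sq_nonneg _) (one_le_aSq α x)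

/-- The weight `|x|^(2α-4)` is form bounded with arbitrarily small bound. -/
lemma exists_integral_weight_le (hN : 5 ≤ N) {α β : ℝ} (hα : 0 < α) (hβ : α - 2 < β) {ε : ℝ}
    (hε : 0 < ε) : ∃ C, 0 ≤ C ∧ ∀ u : Space N → ℂ, IsTest u →
      ∫ x, ‖x‖ ^ (2 * α - 4) * ‖u x‖ ^ 2 ≤
        ε * (∫ x, aSq α x * ‖Laplacian.laplacian u x‖ ^ 2) + ε * (∫ x, V β x ^ 2 * ‖u x‖ ^ 2)
          + C * ∫ x, ‖u x‖ ^ 2 := by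
  obtain ⟨C, hC0, hC⟩ := exists_rpow_le hα hβ hε
  refine ⟨C, hC0, fun u hu => ?_⟩
  have i1 := integrable_mul_normSq (smoothOff_norm_rpow (-4)) hu
  have i2 := integrable_mul_normSq (smoothOff_V_sq β) hu
  have i3 := integrable_normSq hu
  have h1 : ∫ x, ‖x‖ ^ (2 * α - 4) * ‖u x‖ ^ 2 ≤
      ∫ x, (ε * (‖x‖ ^ (-4 : ℝ) * ‖u x‖ ^ 2) + ε * (V β x ^ 2 * ‖u x‖ ^ 2) + C * ‖u x‖ ^ 2) := by
    refine integral_mono (integrable_mul_normSq (smoothOff_norm_rpow _) hu)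
      (((i1.const_mul ε).add (i2.const_mul ε)).add (i3.const_mul C)) fun x => ?_
    rcases eq_or_ne x 0 with rfl | hx
    · simp [hu.map_zero]
    · have := mul_le_mul_of_nonneg_right (hC ‖x‖ (norm_pos_iff.2 hx)) (sq_nonneg ‖u x‖)
      simp only [V, rpow_mul_self_sq]
      linarith
  have i12 : Integrable fun x =>
      ε * (‖x‖ ^ (-4 : ℝ) * ‖u x‖ ^ 2) + ε * (V β x ^ 2 * ‖u x‖ ^ 2) :=
    (i1.const_mul ε).add (i2.const_mul ε)
  rw [integral_add i12 (i3.const_mul C), integral_add (i1.const_mul ε) (i2.const_mul ε), integral_const_mul, integral_const_mul,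
    integral_const_mul] at h1
  have h2 := mul_le_mul_of_nonneg_left
    ((rellich hN hu).trans (integral_normSq_laplacian_le α hu)) hε.le
  linarith

lemma rpow_le_mul_sqrt_aSq (α : ℝ) {x : Space N} (hx : x ≠ 0) :
    ‖x‖ ^ (2 * α - 2) ≤ (1 + ‖x‖ ^ α) * ‖x‖ ^ (α - 2) := by
  have h0 : 0 < ‖x‖ := norm_pos_iff.2 hx
  have h1 : ‖x‖ ^ (2 * α - 2) = ‖x‖ ^ α * ‖x‖ ^ (α - 2) := by
    rw [← Real.rpow_add h0]; congr 1; ring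
  rw [h1]
  have : 0 ≤ ‖x‖ ^ (α - 2) := by positivity
  nlinarith

/-- The weighted gradient term is controlled by the second order and zeroth order ones. -/
lemma integral_gradSq_le (α : ℝ) {δ : ℝ} (hδ : 0 < δ) {u : Space N → ℂ} (hu : IsTest u) :
    ∫ x, ‖x‖ ^ (2 * α - 2) * gradSq u x ≤ δ * (∫ x, aSq α x * ‖Laplacian.laplacian u x‖ ^ 2)
      + (|(2 * α - 2) * (2 * α - 2 + N - 2) / 2| + 1 / (4 * δ))
        * ∫ x, ‖x‖ ^ (2 * α - 4) * ‖u x‖ ^ 2 := by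
  have h1 := integral_rpow_mul_gradSq (2 * α - 2) hu
  rw [show 2 * α - 2 - 2 = 2 * α - 4 by ring] at h1
  have i1 := integrable_mul_normSq (smoothOff_norm_rpow (2 * α - 4)) hu
  have i2 := integrable_mul_normSq (smoothOff_aSq α) hu.laplacian
  have hY : 0 ≤ ∫ x, ‖x‖ ^ (2 * α - 4) * ‖u x‖ ^ 2 := integral_nonneg fun x => by positivity
  have h2 : -∫ x, ‖x‖ ^ (2 * α - 2) * (starRingEnd ℂ (u x) * Laplacian.laplacian u x).re
      ≤ δ * (∫ x, aSq α x * ‖Laplacian.laplacian u x‖ ^ 2)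
        + 1 / (4 * δ) * ∫ x, ‖x‖ ^ (2 * α - 4) * ‖u x‖ ^ 2 := by
    rw [← integral_neg, ← integral_const_mul, ← integral_const_mul,
      ← integral_add (i2.const_mul _) (i1.const_mul _)]
    have i3 := ((hu.laplacian.mul_left hu.conj.smoothOff).mul_left
      (smoothOff_norm_rpow (2 * α - 2)).ofReal).integrable.re
    refine integral_mono ?_ ((i2.const_mul _).add (i1.const_mul _)) fun x => ?_
    · exact (i3.congr (Eventually.of_forall fun x => Complex.re_ofReal_mul _ _)).neg
    · rcases eq_or_ne x 0 with rfl | hx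
      · simp [hu.map_zero, hu.laplacian.map_zero]
      have h3 := Complex.abs_re_le_norm (starRingEnd ℂ (u x) * Laplacian.laplacian u x)
      rw [norm_mul, RCLike.norm_conj] at h3
      have h4 := neg_abs_le (starRingEnd ℂ (u x) * Laplacian.laplacian u x).re
      have h5 : ‖x‖ ^ (2 * α - 4) = (‖x‖ ^ (α - 2)) ^ 2 := by
        rw [rpow_mul_self_sq]; congr 1; ring
      have h6 : 0 ≤ ‖x‖ ^ (2 * α - 2) := by positivity
      have h7 := rpow_le_mul_sqrt_aSq α hx
      set p := (1 + ‖x‖ ^ α) * ‖Laplacian.laplacian u x‖ with hp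
      set r := ‖x‖ ^ (α - 2) * ‖u x‖ with hr
      have h8 : -(‖x‖ ^ (2 * α - 2) * (starRingEnd ℂ (u x) * Laplacian.laplacian u x).re)
          ≤ p * r := by
        have h9 : -(starRingEnd ℂ (u x) * Laplacian.laplacian u x).re
          ≤ ‖u x‖ * ‖Laplacian.laplacian u x‖ := by linarith
        have h10 := mul_le_mul_of_nonneg_left h9 h6
        have h11 : 0 ≤ ‖u x‖ * ‖Laplacian.laplacian u x‖ := by positivity
        have h12 := mul_le_mul_of_nonneg_right h7 h11
        rw [hp, hr]
        linarith
      have h9 : p * r ≤ δ * p ^ 2 + 1 / (4 * δ) * r ^ 2 := by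
        have h13 : δ * p ^ 2 + 1 / (4 * δ) * r ^ 2 - p * r = (2 * δ * p - r) ^ 2 / (4 * δ) := by
          field_simp; ring
        have : 0 ≤ (2 * δ * p - r) ^ 2 / (4 * δ) := by positivity
        linarith
      have e1 : aSq α x * ‖Laplacian.laplacian u x‖ ^ 2 = p ^ 2 := by rw [hp, aSq]; ring
      have e2 : ‖x‖ ^ (2 * α - 4) * ‖u x‖ ^ 2 = r ^ 2 := by rw [hr, h5]; ring
      simp only [e1, e2]
      exact h8.trans h9
  have h3 := mul_le_mul_of_nonneg_right (le_abs_self ((2 * α - 2) * (2 * α - 2 + N - 2) / 2)) hY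
  linarith

end Inequalities

/-! ### Sectoriality of the form -/

section Sectorial

variable {N : ℕ}

lemma pderiv_aSq (α : ℝ) {x : Space N} (hx : x ≠ 0) (i : Fin N) :
    pderiv i (aSq α) x = 2 * α * (‖x‖ ^ (α - 2) + ‖x‖ ^ (2 * α - 2)) * x i := by
  have e : aSq (N := N) α = fun y => 1 + 2 * ‖y‖ ^ α + ‖y‖ ^ (2 * α) := funext (aSq_eq α)
  have h : HasFDerivAt (fun y : Space N => 1 + 2 * ‖y‖ ^ α + ‖y‖ ^ (2 * α)) _ x :=
    (((hasFDerivAt_norm_rpow_off α hx).const_mul 2).const_add 1).add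
      (hasFDerivAt_norm_rpow_off (2 * α) hx)
  rw [e, pderiv, h.fderiv]
  simp [EuclideanSpace.inner_single_right]
  ring

lemma laplacian_aSq (α : ℝ) {x : Space N} (hx : x ≠ 0) :
    Laplacian.laplacian (aSq (N := N) α) x = 2 * α * (α + N - 2) * ‖x‖ ^ (α - 2)
      + 2 * α * (2 * α + N - 2) * ‖x‖ ^ (2 * α - 2) := by
  have e : aSq (N := N) α = ((fun _ => 1) + (2 : ℝ) • fun y => ‖y‖ ^ α) + fun y => ‖y‖ ^ (2 * α) :=
    funext (aSq_eq α)
  have h : ∀ s : ℝ, ContDiffAt ℝ 2 (fun y : Space N => ‖y‖ ^ s) x := fun s =>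
    (smoothOff_norm_rpow s x hx).of_le two_le_infty
  have h1 : ContDiffAt ℝ 2 (fun _ : Space N => (1 : ℝ)) x := contDiffAt_const
  have h2 : ContDiffAt ℝ 2 ((2 : ℝ) • fun y : Space N => ‖y‖ ^ α) x := contDiffAt_const.smul (h α)
  have h12 : ContDiffAt ℝ 2
      ((fun _ : Space N => (1 : ℝ)) + (2 : ℝ) • fun y : Space N => ‖y‖ ^ α) x := h1.add h2
  rw [e, ContDiffAt.laplacian_add h12 (h _), ContDiffAt.laplacian_add h1 h2,
    InnerProductSpace.laplacian_smul _ (h α), InnerProductSpace.laplacian_const,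
    laplacian_norm_rpow α hx, laplacian_norm_rpow (2 * α) hx]
  simp only [Pi.zero_apply, smul_eq_mul]
  ring

lemma norm_fderiv_gradient_aSq_le {α : ℝ} (hα : 0 < α) {x : Space N} (hx : x ≠ 0)
    (u : Space N → ℂ) :
    ‖fderiv ℝ u x (gradient (aSq α) x)‖
      ≤ 2 * α * (1 + ‖x‖ ^ α) * (‖x‖ ^ (α - 1) * Real.sqrt (gradSq u x)) := by
  have h0 : 0 < ‖x‖ := norm_pos_iff.2 hx
  set A := 2 * α * (‖x‖ ^ (α - 2) + ‖x‖ ^ (2 * α - 2)) with hA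
  have hA0 : 0 ≤ A := by positivity
  have hAx : A * ‖x‖ = 2 * α * (1 + ‖x‖ ^ α) * ‖x‖ ^ (α - 1) := by
    have e1 : ‖x‖ ^ (α - 1) = ‖x‖ ^ (α - 2) * ‖x‖ := by
      rw [← Real.rpow_add_one h0.ne']; congr 1; ring
    have e2 : ‖x‖ ^ (2 * α - 2) = ‖x‖ ^ α * ‖x‖ ^ (α - 2) := by
      rw [← Real.rpow_add h0]; congr 1; ring
    rw [hA, e1, e2]; ring
  have h1 : ‖fderiv ℝ u x (gradient (aSq α) x)‖ ≤ ∑ i, (A * |x i|) * ‖pderiv i u x‖ := by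
    rw [fderiv_gradient]
    refine (norm_sum_le _ _).trans (Finset.sum_le_sum fun i _ => le_of_eq ?_)
    rw [norm_mul, Complex.norm_real, pderiv_aSq α hx, ← hA, norm_mul, Real.norm_of_nonneg hA0,
      Real.norm_eq_abs]
  have h2 := Real.sum_mul_le_sqrt_mul_sqrt Finset.univ (fun i => A * |x i|)
    (fun i => ‖pderiv i u x‖)
  have h3 : ∑ i, (A * |x i|) ^ 2 = (A * ‖x‖) ^ 2 := by
    rw [mul_pow, EuclideanSpace.real_norm_sq_eq, Finset.mul_sum]
    exact Finset.sum_congr rfl fun i _ => by rw [mul_pow, sq_abs]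
  rw [h3, Real.sqrt_sq (by positivity), hAx] at h2
  refine h1.trans (h2.trans (le_of_eq ?_))
  rw [gradSq]; ring

lemma abs_laplacian_aSq_le (hN : 5 ≤ N) {α : ℝ} (hα : 0 < α) {x : Space N} (hx : x ≠ 0) :
    |Laplacian.laplacian (aSq (N := N) α) x|
      ≤ 2 * α * (2 * α + N - 2) * ((1 + ‖x‖ ^ α) * ‖x‖ ^ (α - 2)) := by
  have h0 : 0 < ‖x‖ := norm_pos_iff.2 hx
  have hN' : (5 : ℝ) ≤ N := by exact_mod_cast hN
  have e2 : ‖x‖ ^ (2 * α - 2) = ‖x‖ ^ α * ‖x‖ ^ (α - 2) := by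
    rw [← Real.rpow_add h0]; congr 1; ring
  have p1 : 0 ≤ 2 * α * (α + N - 2) := mul_nonneg (by positivity) (by linarith)
  have p2 : 0 ≤ 2 * α * (2 * α + N - 2) := mul_nonneg (by positivity) (by linarith)
  have p3 : 2 * α * (α + N - 2) ≤ 2 * α * (2 * α + N - 2) :=
    mul_le_mul_of_nonneg_left (by linarith) (by positivity)
  rw [laplacian_aSq α hx, abs_of_nonneg (by positivity), e2]
  have h1 := mul_le_mul_of_nonneg_right p3 (show 0 ≤ ‖x‖ ^ (α - 2) by positivity)
  linarith

/-- Young's inequality; the remaining weights `|x|^(2α - 2)` and `|x|^(2α - 4)` come from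
`|∇a²|² / a²` and `(Δa²)² / a²`. -/
lemma norm_lowerOrder_le (hN : 5 ≤ N) {α : ℝ} (hα : 0 < α) {u : Space N → ℂ} (hu : IsTest u)
    (x : Space N) :
    ‖lowerOrder α u u x‖ ≤ 1 / 4 * (aSq α x * ‖Laplacian.laplacian u x‖ ^ 2)
      + 32 * α ^ 2 * (‖x‖ ^ (2 * α - 2) * gradSq u x)
      + 2 * (2 * α * (2 * α + N - 2)) ^ 2 * (‖x‖ ^ (2 * α - 4) * ‖u x‖ ^ 2) := by
  have hg : 0 ≤ gradSq u x := Finset.sum_nonneg fun i _ => by positivity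
  rcases eq_or_ne x 0 with rfl | hx
  · have h0 : lowerOrder α u u 0 = 0 := by
      simp [lowerOrder, hu.laplacian.map_zero]
    have h1 : 0 ≤ aSq α (0 : Space N) := zero_le_one.trans (one_le_aSq α 0)
    rw [h0, norm_zero]
    positivity
  · set c := 2 * α * (2 * α + N - 2)
    set p := (1 + ‖x‖ ^ α) * ‖Laplacian.laplacian u x‖ with hp
    set m₁ := ‖x‖ ^ (α - 1) * Real.sqrt (gradSq u x) with hm₁
    set m₂ := ‖x‖ ^ (α - 2) * ‖u x‖ with hm₂
    have h1 : ‖lowerOrder α u u x‖ ≤ p * (4 * α * m₁ + c * m₂) := by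
      rw [lowerOrder]
      refine (norm_add_le _ _).trans ?_
      rw [norm_mul, norm_mul, norm_mul, norm_mul, RCLike.norm_conj, RCLike.norm_conj,
        Complex.norm_real, Real.norm_eq_abs, Complex.norm_ofNat]
      have h2 := mul_le_mul_of_nonneg_right (norm_fderiv_gradient_aSq_le hα hx u)
        (norm_nonneg (Laplacian.laplacian u x))
      have h3 := mul_le_mul_of_nonneg_right (abs_laplacian_aSq_le hN hα hx)
        (show 0 ≤ ‖Laplacian.laplacian u x‖ * ‖u x‖ by positivity)
      have e : p * (4 * α * m₁ + c * m₂)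
        = 2 * (2 * α * (1 + ‖x‖ ^ α) * m₁ * ‖Laplacian.laplacian u x‖)
          + c * ((1 + ‖x‖ ^ α) * ‖x‖ ^ (α - 2)) * (‖Laplacian.laplacian u x‖ * ‖u x‖) := by
        rw [hp, hm₂]; ring
      rw [e]
      linarith
    have e1 : aSq α x * ‖Laplacian.laplacian u x‖ ^ 2 = p ^ 2 := by rw [hp, aSq]; ring
    have e2 : ‖x‖ ^ (2 * α - 2) * gradSq u x = m₁ ^ 2 := by
      rw [hm₁, mul_pow, Real.sq_sqrt hg, rpow_mul_self_sq]; congr 2; ring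
    have e3 : ‖x‖ ^ (2 * α - 4) * ‖u x‖ ^ 2 = m₂ ^ 2 := by
      rw [hm₂, mul_pow, rpow_mul_self_sq]; congr 2; ring
    rw [e1, e2, e3]
    nlinarith [sq_nonneg (p / 2 - (4 * α * m₁ + c * m₂)), sq_nonneg (4 * α * m₁ - c * m₂)]

/-- The lower order part of the form is bounded by half of its principal part and a multiple of
the `L²` norm. -/
lemma exists_norm_integral_lowerOrder_le (hN : 5 ≤ N) {α β : ℝ} (hα : 0 < α) (hβ : α - 2 < β) :
    ∃ C, 0 ≤ C ∧ ∀ u : Space N → ℂ, IsTest u →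
      ‖∫ x, lowerOrder α u u x‖ ≤ 1 / 2 * (∫ x, aSq α x * ‖Laplacian.laplacian u x‖ ^ 2)
        + 1 / 2 * (∫ x, V β x ^ 2 * ‖u x‖ ^ 2) + C * ∫ x, ‖u x‖ ^ 2 := by
  -- `δ` makes the coefficient `32 α² δ` of the second order term equal to `1/8`
  set δ := 1 / (256 * α ^ 2) with hδ
  have hδ0 : 0 < δ := by positivity
  set K := |(2 * α - 2) * (2 * α - 2 + N - 2) / 2| + 1 / (4 * δ) with hK
  set C₁ := 32 * α ^ 2 * K + 2 * (2 * α * (2 * α + N - 2)) ^ 2 with hC₁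
  have hC₁0 : 0 ≤ C₁ := by positivity
  obtain ⟨C, hC0, hC⟩ := exists_integral_weight_le hN hα hβ
    (show 0 < 1 / (8 * (C₁ + 1)) by positivity)
  refine ⟨C₁ * C, by positivity, fun u hu => ?_⟩
  have i1 := integrable_mul_normSq (smoothOff_aSq α) hu.laplacian
  have i2 := integrable_mul_gradSq (smoothOff_norm_rpow (2 * α - 2)) hu
  have i3 := integrable_mul_normSq (smoothOff_norm_rpow (2 * α - 4)) hu
  have i12 : Integrable fun x => 1 / 4 * (aSq α x * ‖Laplacian.laplacian u x‖ ^ 2)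
      + 32 * α ^ 2 * (‖x‖ ^ (2 * α - 2) * gradSq u x) := (i1.const_mul _).add (i2.const_mul _)
  have h1 : ‖∫ x, lowerOrder α u u x‖ ≤ _ := (norm_integral_le_integral_norm _).trans
    (integral_mono (isTest_lowerOrder α hu hu).integrable.norm
      (i12.add (i3.const_mul (2 * (2 * α * (2 * α + N - 2)) ^ 2)))
      fun x => norm_lowerOrder_le hN hα hu x)
  simp only [Pi.add_apply] at h1
  rw [integral_add i12 (i3.const_mul _), integral_add (i1.const_mul _) (i2.const_mul _),
    integral_const_mul, integral_const_mul, integral_const_mul] at h1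
  have h2 := mul_le_mul_of_nonneg_left (integral_gradSq_le α hδ0 hu)
    (show 0 ≤ 32 * α ^ 2 by positivity)
  have h3 := mul_le_mul_of_nonneg_left (hC u hu) hC₁0
  have hX : 0 ≤ ∫ x, aSq α x * ‖Laplacian.laplacian u x‖ ^ 2 := integral_nonneg fun x =>
    mul_nonneg (zero_le_one.trans (one_le_aSq α x)) (sq_nonneg _)
  have hP : 0 ≤ ∫ x, V β x ^ 2 * ‖u x‖ ^ 2 := integral_nonneg fun x => by positivity
  rw [← hK] at h2
  set X := ∫ x, aSq α x * ‖Laplacian.laplacian u x‖ ^ 2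
  set P := ∫ x, V β x ^ 2 * ‖u x‖ ^ 2
  set Y := ∫ x, ‖x‖ ^ (2 * α - 4) * ‖u x‖ ^ 2
  set R := ∫ x, ‖u x‖ ^ 2
  have h4 : 32 * α ^ 2 * (δ * X) = 1 / 8 * X := by rw [hδ]; field_simp; ring
  have h5 : C₁ * (1 / (8 * (C₁ + 1))) ≤ 1 / 8 := by
    rw [mul_one_div, div_le_div_iff₀ (by positivity) (by norm_num)]; linarith
  have h6 := mul_le_mul_of_nonneg_right h5 hX
  have h7 := mul_le_mul_of_nonneg_right h5 hP
  have h8 : C₁ * Y = 32 * α ^ 2 * (K * Y) + 2 * (2 * α * (2 * α + N - 2)) ^ 2 * Y := by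
    rw [hC₁]; ring
  linarith

lemma form_self_eq (α β lam : ℝ) (u : Test N) :
    form α β lam u u = (((∫ x, aSq α x * ‖Laplacian.laplacian (⇑u) x‖ ^ 2)
      + (∫ x, V β x ^ 2 * ‖u x‖ ^ 2) + lam * ∫ x, ‖u x‖ ^ 2 : ℝ) : ℂ)
      + ∫ x, lowerOrder α u u x := by
  have hu := u.isTest
  have i1 := integrable_mul_normSq (smoothOff_aSq α) hu.laplacian
  have i2 := integrable_mul_normSq (smoothOff_V_sq β) hu
  have i3 := integrable_normSq hu
  have i12 : Integrable fun x => aSq α x * ‖Laplacian.laplacian (⇑u) x‖ ^ 2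
      + V β x ^ 2 * ‖u x‖ ^ 2 := i1.add i2
  have i123 : Integrable fun x => aSq α x * ‖Laplacian.laplacian (⇑u) x‖ ^ 2
      + V β x ^ 2 * ‖u x‖ ^ 2 + lam * ‖u x‖ ^ 2 := i12.add (i3.const_mul lam)
  have i123c : Integrable fun x => ((aSq α x * ‖Laplacian.laplacian (⇑u) x‖ ^ 2
      + V β x ^ 2 * ‖u x‖ ^ 2 + lam * ‖u x‖ ^ 2 : ℝ) : ℂ) := i123.ofReal
  rw [← integral_const_mul, ← integral_add i1 i2, ← integral_add i12 (i3.const_mul lam),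
    ← integral_complex_ofReal, ← integral_add i123c (isTest_lowerOrder α hu hu).integrable,
    form]
  refine integral_congr_ae (Eventually.of_forall fun x => ?_)
  have e1 := Complex.conj_mul' (Laplacian.laplacian (⇑u) x)
  have e2 := Complex.mul_conj' (u x)
  simp only [lowerOrder]
  push_cast
  linear_combination (aSq α x : ℂ) * e1 + ((V β x : ℂ) ^ 2 + lam) * e2

/-- The lower order part is at most half of the principal part `∫ a² |Δu|² + V² |u|²` plus
`C ‖u‖²`, so its imaginary part is controlled by the real part of the form once `λ₀ ≥ 2 C`. -/
lemma exists_form_mem_cone (hN : 5 ≤ N) {α β : ℝ} (hα : 0 < α) (hβ : α - 2 < β) :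
    ∃ lam₀ : ℝ, 0 < lam₀ ∧ ∀ u : Test N, form α β lam₀ u u ∈ cone := by
  obtain ⟨C, hC0, hC⟩ := exists_norm_integral_lowerOrder_le hN hα hβ
  refine ⟨2 * C + 1, by positivity, fun u => ?_⟩
  have h := hC u u.isTest
  have hR : 0 ≤ ∫ x, ‖u x‖ ^ 2 := integral_nonneg fun x => by positivity
  rw [form_self_eq]
  simp only [cone, Set.mem_ofPred_eq, Complex.add_im, Complex.add_re, Complex.ofReal_im,
    Complex.ofReal_re, zero_add]
  have h1 := Complex.abs_im_le_norm (∫ x, lowerOrder α u u x)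
  have h2 := (neg_le_neg (Complex.abs_re_le_norm (∫ x, lowerOrder α u u x))).trans
    (neg_abs_le (∫ x, lowerOrder α u u x).re)
  linarith

end Sectorial

end BiLaplace

theorem theorem2p6 (N : ℕ) (hN : 5 ≤ N) (α β : ℝ) (hα : 0 < α) (hβ : max (α - 2) 0 < β) :
    ∃ lam₀ : ℝ, 0 < lam₀ ∧
    ∃ (A : BiLaplace.L2 N →ₗ.[ℂ] BiLaplace.L2 N)
      (S : ℝ → BiLaplace.L2 N →L[ℂ] BiLaplace.L2 N),
      -- `A` extends `a² Δ² + V²` on `C_c^∞(ℝ^N \ {0})`, and `-A` generates `S`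
      (∀ φ : BiLaplace.Test N, ∃ f : BiLaplace.L2 N,
        (f : BiLaplace.Space N → ℂ) =ᵐ[volume] BiLaplace.diffExpr α β (⇑φ) ∧
        (BiLaplace.toL2 φ, f) ∈ A.graph) ∧
      BiLaplace.IsAnalyticSemigroup S ∧
      BiLaplace.IsGenerator S (-A) ∧
      ∀ lam : ℝ, lam₀ ≤ lam →
        -- the form is densely defined, accretive, continuous, closable, its closure well defined
        DenseRange (BiLaplace.toL2 : BiLaplace.Test N → BiLaplace.L2 N) ∧
        BiLaplace.Accretive (BiLaplace.form (N := N) α β lam) ∧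
        BiLaplace.ContinuousForm BiLaplace.toL2 (BiLaplace.form (N := N) α β lam) ∧
        BiLaplace.Closable BiLaplace.toL2 (BiLaplace.form (N := N) α β lam) ∧
        (∀ u ∈ BiLaplace.closureDomain BiLaplace.toL2 (BiLaplace.form (N := N) α β lam),
          ∀ v ∈ BiLaplace.closureDomain BiLaplace.toL2 (BiLaplace.form (N := N) α β lam),
            ∃! c : ℂ, BiLaplace.ClosureValue BiLaplace.toL2
              (BiLaplace.form (N := N) α β lam) u v c) ∧
        -- the associated operator `A_λ = A + λ`, and the semigroup that `-A_λ` generates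
        ∃ (Alam : BiLaplace.L2 N →ₗ.[ℂ] BiLaplace.L2 N)
          (T : ℝ → BiLaplace.L2 N →L[ℂ] BiLaplace.L2 N),
          (∀ u f : BiLaplace.L2 N, (u, f) ∈ Alam.graph ↔
            BiLaplace.AssociatedGraph BiLaplace.toL2 (BiLaplace.form (N := N) α β lam) u f) ∧
          BiLaplace.IsAnalyticContractionSemigroup T ∧
          BiLaplace.IsGenerator T (-Alam) ∧
          (∀ u f : BiLaplace.L2 N, (u, f) ∈ A.graph ↔ (u, f + (lam : ℂ) • u) ∈ Alam.graph) ∧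
          ∀ t : ℝ, 0 ≤ t → S t = (Real.exp (lam * t) : ℂ) • T t := by
  obtain ⟨lam₀, h0, hs⟩ := BiLaplace.exists_form_mem_cone hN hα ((le_max_left _ _).trans_lt hβ)
  have hd := BiLaplace.denseRange_toL2 (show 0 < N by omega)
  obtain ⟨A, S, hA, hS, hgen, h⟩ := BiLaplace.exists_operator_and_semigroup
    (j := BiLaplace.toL2Lin) (L := BiLaplace.toL2Lin ∘ₗ BiLaplace.diffOp α β) hd
    (q := BiLaplace.form α β) (fun lam u v => BiLaplace.form_eq_inner α β lam u v) hs
  exact ⟨lam₀, h0, A, S, fun φ => ⟨BiLaplace.toL2 (BiLaplace.diffOp α β φ),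
    BiLaplace.coeFn_toL2 _, hA φ⟩, hS, hgen, fun lam hlam => ⟨hd, h lam hlam⟩⟩
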